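/- **Setting.** Let $a_1,\dots,a_m\sim N(0,I_n)$ be standard Gaussian vectors in $\mathbb R^n$ ($m\ge 1$), let $\mathcal Y\subset\mathbb R$ be closed, let $x_0\in\mathbb R^n$ with $\|x_0\|_2=1$, and let $$y_i=f_i(\langle a_i,x_0\rangle),\qquad i=1,\dots,m,$$ where $f_1,\dots,f_m$ are independent copies of a (possibly random) measurable function $f:\mathbb R\to\mathcal Y$, and all $a_i$ and $f_j$ are jointly independent. The available data are the $a_i$ and a vector $\tilde y\in\mathcal Y^m$ which may deviate from $y$ in an arbitrary way (also depending on all the $a_i$ and $f_i$); put $\varepsilon=\big(\frac1m\sum_{i=1}^m|\tilde y_i-y_i|^2\big)^{1/2}$. Let $\mathcal L:\mathbb R\times\mathcal Y\to\mathbb R$ be convex and twice continuously differentiable in the first variable, with derivatives $\mathcal L'=\partial_v\mathcal L$ and $\mathcal L''=\partial_v^2\mathcal L$. Suppose that $|\mathcal L'(v,y)-\mathcal L'(v,y')|\le\Lambda|y-y'|$ for all $v\in\mathbb R$, $y,y'\in\mathcal Y$, and that $\mathcal L''(v,y)\ge\mathcal F(v)>0$ for all $(v,y)\in\mathbb R\times\mathcal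 Y$ and some continuous $\mathcal F:\mathbb R\to(0,\infty)$. Let $g\sim N(0,1)$ be independent of $f$, and suppose that $\mu\in\mathbb R$ and $\sigma,\eta\in[0,\infty)$ satisfy $$0=\mathbb E[\mathcal L'(\mu g,f(g))\,g],\qquad \sigma^2=\mathbb E[\mathcal L'(\mu g,f(g))^2],\qquad \eta^2=\mathbb E[\mathcal L'(\mu g,f(g))^2g^2].$$ Let $K\subset\mathbb R^n$ be bounded and convex with $\mu x_0\in K$, and let $w=w(K-\mu x_0)$, where $w(S)=\mathbb E[\sup_{x\in S}\langle \mathbf g,x\rangle]$ with $\mathbf g\sim N(0,I_n)$ is the global Gaussian mean width. **Theorem.** There is a numerical constant $c>0$, and for all $\delta,\Lambda,\kappa>0$ there is a constant $C>0$ depending only on $\delta$, $\Lambda$, $\kappa$, such that the following holds in the above setting. Write $$t=C\cdot\max\{1,\sigma,\eta\}\cdot\Big(\Big(\frac{w^2}{m}\Big)^{1/4}+\varepsilon\Big).$$ Let $R\in\mathbb R$ be such that, almost surely, $K\subset\{x:\|x-\mu x_0\|_2\le R\}$ or $t\le R$, and suppose that $\mathcal F(v)\ge\kappa$ whenever $|v|\le\max\{32R,\,c|\mu|\}$.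 If $$m\ge C\cdot w(K-\mu x_0)^2,$$ then, with probability at least $1-\delta$, every minimizer $\hat x$ of $$\min_{x\in K}\ \frac1m\sum_{i=1}^m\mathcal L(\langle a_i,x\rangle,\tilde y_i)$$ satisfies $$\|\hat x-\mu x_0\|_2\le t=C\cdot\max\{1,\sigma,\eta\}\cdot\Big(\Big(\frac{w(K-\mu x_0)^2}{m}\Big)^{1/4}+\varepsilon\Big).$$ (Since $K$ is bounded and $\mathcal F$ is continuous and positive, such $R$ and $\kappa$ always exist: take $R$ with $K\subset\{x:\|x-\mu x_0\|_2\le R\}$ and $\kappa=\min\{\mathcal F(v):|v|\le\max\{32R,c|\mu|\}\}$.) -/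

import Mathlib

open MeasureTheory ProbabilityTheory

namespace GenLasso

/-- The (global Gaussian) mean width `w(S) = E[sup_{x ∈ S} ⟨g, x⟩]`, where `g` is a standard
Gaussian vector in `ℝⁿ`. -/
noncomputable def meanWidth {n : ℕ} (S : Set (EuclideanSpace ℝ (Fin n))) : ℝ :=
  ∫ g, sSup ((fun x => inner ℝ g x) '' S) ∂(stdGaussian (EuclideanSpace ℝ (Fin n)))

/-- First derivative of a loss `L : (v, y) ↦ L v y` in its first variable. -/
noncomputable def lossDeriv (L : ℝ → ℝ → ℝ) (v y : ℝ) : ℝ :=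
  deriv (fun u => L u y) v

/-- Second derivative of a loss `L : (v, y) ↦ L v y` in its first variable. -/
noncomputable def lossDeriv₂ (L : ℝ → ℝ → ℝ) (v y : ℝ) : ℝ :=
  iteratedDeriv 2 (fun u => L u y) v

/-- Assumptions on the loss `L : ℝ × Y → ℝ` (only its values on `ℝ × Y` matter): it is convex and
twice continuously differentiable in the first variable, its first derivative is Lipschitz in the
second variable with constant `Λ`, and its second derivative is at least `F v`, where `F` is
continuous and positive. -/
structure IsCurvedLoss (Y : Set ℝ) (L : ℝ → ℝ → ℝ) (Λ : ℝ) (F : ℝ → ℝ) : Prop where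
  convex : ∀ y ∈ Y, ConvexOn ℝ Set.univ (fun v => L v y)
  contDiff : ∀ y ∈ Y, ContDiff ℝ 2 (fun v => L v y)
  lipschitz : ∀ v : ℝ, ∀ y ∈ Y, ∀ y' ∈ Y,
    |lossDeriv L v y - lossDeriv L v y'| ≤ Λ * |y - y'|
  continuous_curvature : Continuous F
  curvature_pos : ∀ v, 0 < F v
  curvature_le : ∀ v : ℝ, ∀ y ∈ Y, F v ≤ lossDeriv₂ L v y

/-- The random ingredients of the observation model with isotropic Gaussian measurements: the
measurement vectors `a i ∼ N(0, Iₙ)` and the random seeds `s i ∼ ν` are all independent. The `i`-th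
independent copy of the random non-linearity is the function `v ↦ f (s i) v`; jointly measurable,
with values in `Y`. A deterministic `f` is one that ignores its seed. -/
structure IsObservationModel {n m : ℕ} {Ω Ξ : Type*} [MeasurableSpace Ω] [MeasurableSpace Ξ]
    (P : Measure Ω) (ν : Measure Ξ) (Y : Set ℝ) (f : Ξ → ℝ → ℝ)
    (a : Fin m → Ω → EuclideanSpace ℝ (Fin n)) (s : Fin m → Ω → Ξ) : Prop where
  measurable_f : Measurable (fun p : Ξ × ℝ => f p.1 p.2)
  range_f : ∀ r v, f r v ∈ Y
  measurable_a : ∀ i, Measurable (a i)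
  measurable_s : ∀ i, Measurable (s i)
  law_a : ∀ i, P.map (a i) = stdGaussian (EuclideanSpace ℝ (Fin n))
  law_s : ∀ i, P.map (s i) = ν
  indep_pair : ∀ i, IndepFun (a i) (s i) P
  indep : iIndepFun (fun i ω => (a i ω, s i ω)) P

/-- The joint law of `(g, r)`: a standard Gaussian variable `g ∼ N(0, 1)` and an independent seed
`r ∼ ν` of the random non-linearity. -/
noncomputable def scalarLaw {Ξ : Type*} [MeasurableSpace Ξ] (ν : Measure Ξ) : Measure (ℝ × Ξ) :=
  (gaussianReal 0 1).prod ν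

/-- The random variable `L'(μ g, f(g))`. -/
noncomputable def residual {Ξ : Type*} (L : ℝ → ℝ → ℝ) (f : Ξ → ℝ → ℝ) (μ : ℝ) (p : ℝ × Ξ) : ℝ :=
  lossDeriv L (μ * p.1) (f p.2 p.1)

/-- The parameters `μ, σ, η` of the model are well defined and given by
`0 = E[L'(μ g, f(g)) g]`, `σ² = E[L'(μ g, f(g))²]`, `η² = E[L'(μ g, f(g))² g²]`. -/
structure IsModelParam {Ξ : Type*} [MeasurableSpace Ξ] (ν : Measure Ξ) (L : ℝ → ℝ → ℝ)
    (f : Ξ → ℝ → ℝ) (μ σ η : ℝ) : Prop where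
  sigma_nonneg : 0 ≤ σ
  eta_nonneg : 0 ≤ η
  memLp_sigma : MemLp (residual L f μ) 2 (scalarLaw ν)
  memLp_eta : MemLp (fun p => residual L f μ p * p.1) 2 (scalarLaw ν)
  mu_eq : ∫ p, residual L f μ p * p.1 ∂(scalarLaw ν) = 0
  sigma_sq : σ ^ 2 = ∫ p, residual L f μ p ^ 2 ∂(scalarLaw ν)
  eta_sq : η ^ 2 = ∫ p, residual L f μ p ^ 2 * p.1 ^ 2 ∂(scalarLaw ν)

/-- The empirical loss `x ↦ (1/m) ∑ᵢ L(⟨aᵢ, x⟩, ỹᵢ)`. -/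
noncomputable def empLoss {n m : ℕ} (L : ℝ → ℝ → ℝ) (a : Fin m → EuclideanSpace ℝ (Fin n))
    (y : Fin m → ℝ) (x : EuclideanSpace ℝ (Fin n)) : ℝ :=
  (1 / (m : ℝ)) * ∑ i, L (inner ℝ (a i) x) (y i)

/-- `x` solves: minimize the empirical loss subject to `x ∈ K`. -/
def IsEstimate {n m : ℕ} (L : ℝ → ℝ → ℝ) (a : Fin m → EuclideanSpace ℝ (Fin n))
    (y : Fin m → ℝ) (K : Set (EuclideanSpace ℝ (Fin n))) (x : EuclideanSpace ℝ (Fin n)) : Prop :=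
  x ∈ K ∧ IsMinOn (empLoss L a y) K x

/-- The adversarial noise parameter `ε = ((1/m) ∑ᵢ |ỹᵢ - yᵢ|²)^{1/2}`. -/
noncomputable def advNoise {m : ℕ} (y' y : Fin m → ℝ) : ℝ :=
  Real.sqrt ((1 / (m : ℝ)) * ∑ i, |y' i - y i| ^ 2)

/-- The error bound `C · max{1, σ, η} · ((w² / m)^{1/4} + ε)`. -/
noncomputable def errorBound (C σ η w : ℝ) (m : ℕ) (ε : ℝ) : ℝ :=
  (C * max 1 (max σ η)) * ((w ^ 2 / (m : ℝ)) ^ (1 / 4 : ℝ) + ε)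

end GenLasso

/-! Put S = K - μx₀, w = w(S), M = max{1, σ, η}, and compare the empirical loss at μx₀ with its
value at μx₀ + tu for a unit vector u. Taylor's formula bounds m times the increase from below by a
multiplier term t ∑ zᵢ⟨aᵢ, u⟩ with zᵢ = L'(μ⟨aᵢ, x₀⟩, yᵢ), minus a corruption term tΛ ∑ |ỹᵢ - yᵢ|
|⟨aᵢ, u⟩|, plus a curvature term of order κt². The curvature is at least κ only on a bounded
interval, so ⟨aᵢ, u⟩² is replaced there by a smaller bounded Lipschitz bump that vanishes when ⟨aᵢ,
u⟩ or ⟨aᵢ, x₀⟩ is large. If the bumps sum to order m, the second moment is O(m) and the multiplier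
sum is not too negative, the loss strictly increases at distance t. By convexity no minimizer can
then lie farther away: `norm_sub_le_of_regularDirection`.

A minimizer at distance more than t gives a direction u with ru ∈ S, where r = C M s, s =
(w²/m)^{1/4}, is the value of t at ε = 0; this uses only that S is star-shaped. The set of such u is
deterministic although ε is random, and its mean width is at most w/r. Since w = s²√m, the
multiplier bound √m M (w/r + 1) is of order s per observation, which t dominates. This balance
produces the fourth root.

Three uniform estimates remain. The bumps are compared with a Gaussian process by contraction
(`integral_iSup_sum_centred_le`), followed by Markov's inequality. The second moment follows by
Gaussian linearization of the squares and concentration of Gaussian suprema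
(`measure_exists_sum_inner_sq_ge_le`, `lintegral_exp_iSup_inner_le`). For the multiplier, aᵢ is
split along x₀: zᵢ is independent of the orthogonal part, and the parallel part is centred by the
definition of μ (`measure_exists_multiplier_le`). All are proved for finite families and extended by
density. -/

namespace GenLasso

/-! ### Finite suprema -/

section Supremum

theorem abs_iSup_le_sum {ι : Type*} [Fintype ι] [Nonempty ι] (f : ι → ℝ) : |⨆ j, f j| ≤ ∑ j, |f j| := by
  obtain ⟨j, hj⟩ := exists_eq_ciSup_of_finite (f := f)
  rw [← hj]
  exact Finset.single_le_sum (f := fun j => |f j|) (fun _ _ => abs_nonneg _) (Finset.mem_univ j)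

variable {ι : Type*} [Finite ι]

theorem le_iSup_fin (f : ι → ℝ) (j : ι) : f j ≤ ⨆ j, f j :=
  le_ciSup (Set.finite_range f).bddAbove j

variable [Nonempty ι]

theorem integrable_iSup {α : Type*} [MeasurableSpace α] {P : Measure α} {f : ι → α → ℝ}
    (hf : ∀ j, Integrable (f j) P) : Integrable (fun x => ⨆ j, f j x) P := by
  have := Fintype.ofFinite ι
  have hm : AEMeasurable (fun x => ⨆ j, f j x) P :=
    AEMeasurable.iSup fun j => (hf j).aestronglyMeasurable.aemeasurable
  refine Integrable.mono' (integrable_finsetSum Finset.univ fun j _ => (hf j).abs)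
    hm.aestronglyMeasurable (.of_forall fun x => ?_)
  simpa using abs_iSup_le_sum fun j => f j x

end Supremum

/-! ### Invariance properties of standard Gaussian vectors -/

section Gaussian

variable {E : Type*} [NormedAddCommGroup E] [InnerProductSpace ℝ E] [FiniteDimensional ℝ E]
  [MeasurableSpace E] [BorelSpace E]

theorem integrable_inner_stdGaussian (u : E) :
    Integrable (fun x => inner ℝ x u) (stdGaussian E) := by
  simpa [real_inner_comm] using
    IsGaussian.integrable_dual (stdGaussian E) (innerSL ℝ u)

theorem stdGaussian_map_inner (u : E) :
    (stdGaussian E).map (fun x => inner ℝ x u) = gaussianReal 0 (‖u‖₊ ^ 2) := by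
  have h := IsGaussian.map_eq_gaussianReal (μ := stdGaussian E) (innerSL ℝ u)
  rw [integral_strongDual_stdGaussian, variance_dual_stdGaussian, innerSL_apply_norm] at h
  have h2 : (fun x => inner ℝ x u) = ⇑(innerSL ℝ u) := by
    ext x; simp [real_inner_comm]
  rw [h2, h]
  congr 1
  ext
  simp

theorem stdGaussian_map_inner_of_norm_eq_one {u : E} (hu : ‖u‖ = 1) :
    (stdGaussian E).map (fun x => inner ℝ x u) = gaussianReal 0 1 := by
  rw [stdGaussian_map_inner]
  congr 1
  ext
  simp [hu]

theorem stdGaussian_map_smul_charFun (r : ℝ) (t : E) :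
    charFun ((stdGaussian E).map (fun x => r • x)) t
      = Complex.exp (-(r * ‖t‖) ^ 2 / 2) := by
  rw [charFun_map_smul, charFun_stdGaussian, norm_smul, Real.norm_eq_abs]
  congr 3
  norm_cast
  rw [mul_pow, mul_pow, sq_abs]

/-- A linear combination of independent standard Gaussian vectors is a multiple of a standard
Gaussian vector. -/
theorem pi_stdGaussian_map_sum_smul {m : ℕ} (z : Fin m → ℝ) :
    (Measure.pi fun _ : Fin m => stdGaussian E).map (fun a => ∑ i, z i • a i)
      = (stdGaussian E).map (fun x => Real.sqrt (∑ i, z i ^ 2) • x) := by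
  have h1 : (Measure.pi fun _ : Fin m => stdGaussian E).map (fun a => ∑ i, z i • a i)
      = (Measure.pi fun i : Fin m => (stdGaussian E).map (fun x => z i • x)).map
        (fun a => ∑ i, a i) := by
    have hi : ∀ i, IsProbabilityMeasure ((stdGaussian E).map (fun x => z i • x)) := fun i =>
      Measure.isProbabilityMeasure_map (by fun_prop)
    rw [← Measure.pi_map_pi (μ := fun _ : Fin m => stdGaussian E)
      (f := fun i x => z i • x) (fun i => by fun_prop), Measure.map_map (by fun_prop)
      (by fun_prop)]
    rfl
  have hi : ∀ i, IsProbabilityMeasure ((stdGaussian E).map (fun x => z i • x)) := fun i =>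
    Measure.isProbabilityMeasure_map (by fun_prop)
  have := Measure.isProbabilityMeasure_map (μ := Measure.pi fun _ : Fin m => stdGaussian E)
    (f := fun a => ∑ i, z i • a i) (Measurable.aemeasurable (by fun_prop))
  have := Measure.isProbabilityMeasure_map (μ := stdGaussian E)
    (f := fun x => Real.sqrt (∑ i, z i ^ 2) • x) (by fun_prop)
  apply Measure.ext_of_charFun
  rw [h1, charFun_map_sum_pi_eq_prod]
  ext t
  simp_rw [Finset.prod_apply, stdGaussian_map_smul_charFun, ← Complex.exp_sum]
  congr 1
  norm_cast
  rw [mul_pow, Real.sq_sqrt (Finset.sum_nonneg fun i _ => sq_nonneg _), ← Finset.sum_div,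
    Finset.sum_neg_distrib, Finset.sum_mul]
  simp_rw [mul_pow]

/-- Split a standard Gaussian vector into its component along a unit vector and an independent
orthogonal part. -/
theorem prod_map_split_eq_stdGaussian {x₀ : E} (hx : ‖x₀‖ = 1) :
    ((gaussianReal 0 1).prod (stdGaussian E)).map
      (fun p => p.1 • x₀ + (p.2 - inner ℝ p.2 x₀ • x₀)) = stdGaussian E := by
  have := Measure.isProbabilityMeasure_map (μ := (gaussianReal 0 1).prod (stdGaussian E))
    (f := fun p : ℝ × E => p.1 • x₀ + (p.2 - inner ℝ p.2 x₀ • x₀)) (by fun_prop)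
  apply Measure.ext_of_charFun
  ext t
  rw [charFun_stdGaussian, charFun_apply, integral_map (by fun_prop) (by fun_prop)]
  -- The orthogonal projection is self-adjoint, so it can be moved from the Gaussian vector to `t`;
  -- the characteristic function then factors and Pythagoras finishes.
  have h : ∀ p : ℝ × E, Complex.exp (↑(inner ℝ (p.1 • x₀ + (p.2 - inner ℝ p.2 x₀ • x₀)) t)
        * Complex.I)
      = Complex.exp (↑(inner ℝ p.1 (inner ℝ x₀ t)) * Complex.I) *
        Complex.exp (↑(inner ℝ p.2 (t - inner ℝ x₀ t • x₀)) * Complex.I) := by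
    intro p
    rw [← Complex.exp_add, ← add_mul, ← Complex.ofReal_add]
    congr 3
    simp only [inner_add_left, inner_sub_left, inner_sub_right, real_inner_smul_left,
      real_inner_smul_right]
    simp
    ring
  simp_rw [h]
  rw [integral_prod_mul (fun g : ℝ => Complex.exp (↑(inner ℝ g (inner ℝ x₀ t)) * Complex.I))
    (fun b : E => Complex.exp (↑(inner ℝ b (t - inner ℝ x₀ t • x₀)) * Complex.I)),
    ← charFun_apply, ← charFun_apply, charFun_gaussianReal, charFun_stdGaussian, ← Complex.exp_add]
  congr 1
  have : ‖t - inner ℝ x₀ t • x₀‖ ^ 2 = ‖t‖ ^ 2 - (inner ℝ x₀ t) ^ 2 := by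
    rw [norm_sub_sq_real, real_inner_smul_right, norm_smul, hx, real_inner_comm]
    simp; ring
  norm_cast
  rw [this]
  push_cast
  ring

theorem stdGaussian_map_neg : (stdGaussian E).map (fun x => -x) = stdGaussian E :=
  stdGaussian_map (LinearIsometryEquiv.neg ℝ : E ≃ₗᵢ[ℝ] E)

/-- Removing the component along a unit vector does not increase expected suprema. -/
theorem integral_iSup_inner_orthogonal_le {ι : Type*} [Finite ι] [Nonempty ι] (u : ι → E) {x₀ : E}
    (hx : ‖x₀‖ = 1) :
    ∫ x, ⨆ j, inner ℝ (x - inner ℝ x x₀ • x₀) (u j) ∂(stdGaussian E)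
      ≤ ∫ x, ⨆ j, inner ℝ x (u j) ∂(stdGaussian E) := by
  -- The projection off `x₀` is the average of the identity and this reflection. The supremum is
  -- convex and the Gaussian law is reflection invariant.
  set T : E ≃ₗᵢ[ℝ] E := (ℝ ∙ x₀).orthogonal.reflection with hT
  have hTx : ∀ x, T x = x - (2 * inner ℝ x x₀) • x₀ := by
    intro x
    rw [hT, Submodule.reflection_orthogonal_apply, Submodule.reflection_singleton_apply]
    simp [hx, real_inner_comm]
    rw [two_smul, ← add_smul]; ring_nf
  have hint : ∀ j, Integrable (fun x : E => inner ℝ x (u j)) (stdGaussian E) := fun j =>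
    integrable_inner_stdGaussian (u j)
  have hTmp : MeasurePreserving T (stdGaussian E) (stdGaussian E) :=
    ⟨T.continuous.measurable, stdGaussian_map T⟩
  have hint' : ∀ j, Integrable (fun x : E => inner ℝ (T x) (u j)) (stdGaussian E) := fun j =>
    hTmp.integrable_comp_of_integrable (hint j)
  have heq : ∫ x, ⨆ j, inner ℝ (T x) (u j) ∂(stdGaussian E)
      = ∫ x, ⨆ j, inner ℝ x (u j) ∂(stdGaussian E) :=
    hTmp.integral_comp T.toHomeomorph.measurableEmbedding (fun x => ⨆ j, inner ℝ x (u j))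
  have hle : ∀ x : E, ⨆ j, inner ℝ (x - inner ℝ x x₀ • x₀) (u j)
      ≤ 2⁻¹ * ((⨆ j, inner ℝ x (u j)) + ⨆ j, inner ℝ (T x) (u j)) := by
    intro x
    refine ciSup_le fun j => ?_
    have h1 := le_iSup_fin (fun j => inner ℝ x (u j)) j
    have h2 := le_iSup_fin (fun j => inner ℝ (T x) (u j)) j
    have h3 : inner ℝ (x - inner ℝ x x₀ • x₀) (u j)
        = 2⁻¹ * (inner ℝ x (u j) + inner ℝ (T x) (u j)) := by
      rw [hTx]; simp only [inner_sub_left, real_inner_smul_left]; ring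
    rw [h3]
    linarith
  have hsup := integrable_iSup hint
  have hsup' := integrable_iSup hint'
  refine (integral_mono (integrable_iSup fun j => ?_) ((hsup.add hsup').const_mul _) hle).trans ?_
  · simp_rw [inner_sub_left, real_inner_smul_left]
    exact (hint j).sub ((integrable_inner_stdGaussian x₀).mul_const _)
  · simp only [Pi.add_apply]
    rw [integral_const_mul, integral_add hsup hsup', heq]
    linarith

theorem integral_pi_iSup_inner_sum {ι : Type*} [Finite ι] (u : ι → E) {m : ℕ} (z : Fin m → ℝ) :
    ∫ a, ⨆ j, inner ℝ (∑ i, z i • a i) (u j) ∂(Measure.pi fun _ : Fin m => stdGaussian E)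
      = Real.sqrt (∑ i, z i ^ 2) * ∫ x, ⨆ j, inner ℝ x (u j) ∂(stdGaussian E) := by
  have hc : Measurable fun x : E => ⨆ j, inner ℝ x (u j) := .iSup fun j => by fun_prop
  rw [← integral_map (f := fun x : E => ⨆ j, inner ℝ x (u j)) (φ := fun a : Fin m → E => ∑ i, z i • a i)
    (Measurable.aemeasurable (by fun_prop)) hc.aestronglyMeasurable,
    pi_stdGaussian_map_sum_smul, integral_map (by fun_prop) hc.aestronglyMeasurable,
    ← integral_const_mul]
  refine integral_congr_ae (.of_forall fun x => ?_)
  simp only [real_inner_smul_left]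
  rw [Real.mul_iSup_of_nonneg (Real.sqrt_nonneg _)]

end Gaussian

/-! ### Concentration of Gaussian suprema by rotation of independent copies -/

section Concentration

variable {E : Type*} [NormedAddCommGroup E] [InnerProductSpace ℝ E]
variable {ι : Type*} [Fintype ι] [Nonempty ι]

/-- The softmax weights of the linear functionals `⟨·, u j⟩` at inverse temperature `β`. -/
noncomputable def softWeight (u : ι → E) (β : ℝ) (j : ι) (x : E) : ℝ :=
  Real.exp (β * inner ℝ x (u j)) / ∑ k, Real.exp (β * inner ℝ x (u k))

/-- The softmax of the linear functionals `⟨·, u j⟩` at inverse temperature `β`. -/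
noncomputable def softMax (u : ι → E) (β : ℝ) (x : E) : ℝ :=
  Real.log (∑ k, Real.exp (β * inner ℝ x (u k))) / β

theorem sum_exp_pos (u : ι → E) (β : ℝ) (x : E) : 0 < ∑ k, Real.exp (β * inner ℝ x (u k)) :=
  Finset.sum_pos (fun _ _ => Real.exp_pos _) Finset.univ_nonempty

theorem softWeight_nonneg (u : ι → E) (β : ℝ) (j : ι) (x : E) : 0 ≤ softWeight u β j x :=
  div_nonneg (Real.exp_pos _).le (sum_exp_pos u β x).le

theorem sum_softWeight (u : ι → E) (β : ℝ) (x : E) : ∑ j, softWeight u β j x = 1 := by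
  simp_rw [softWeight, ← Finset.sum_div]
  exact div_self (sum_exp_pos u β x).ne'

theorem softWeight_le_one (u : ι → E) (β : ℝ) (j : ι) (x : E) : softWeight u β j x ≤ 1 := by
  rw [← sum_softWeight u β x]
  exact Finset.single_le_sum (f := fun j => softWeight u β j x)
    (fun j _ => softWeight_nonneg u β j x) (Finset.mem_univ j)

theorem continuous_softWeight (u : ι → E) (β : ℝ) (j : ι) : Continuous (softWeight u β j) := by
  unfold softWeight
  exact Continuous.div (by fun_prop) (by fun_prop) fun x => (sum_exp_pos u β x).ne'

theorem continuous_softMax (u : ι → E) (β : ℝ) : Continuous (softMax u β) := by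
  unfold softMax
  exact (Continuous.log (by fun_prop) fun x => (sum_exp_pos u β x).ne').div_const _

theorem iSup_le_softMax (u : ι → E) {β : ℝ} (hβ : 0 < β) (x : E) :
    ⨆ j, inner ℝ x (u j) ≤ softMax u β x := by
  refine ciSup_le fun j => ?_
  rw [softMax, le_div_iff₀ hβ, Real.le_log_iff_exp_le (sum_exp_pos u β x), mul_comm]
  exact Finset.single_le_sum (f := fun j => Real.exp (β * inner ℝ x (u j)))
    (fun j _ => (Real.exp_pos _).le) (Finset.mem_univ j)

theorem softMax_le_iSup (u : ι → E) {β : ℝ} (hβ : 0 < β) (x : E) :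
    softMax u β x ≤ (⨆ j, inner ℝ x (u j)) + Real.log (Fintype.card ι) / β := by
  have hc : (0 : ℝ) < Fintype.card ι := by exact_mod_cast Fintype.card_pos
  rw [softMax, div_le_iff₀ hβ, add_mul, div_mul_cancel₀ _ hβ.ne',
    Real.log_le_iff_le_exp (sum_exp_pos u β x), Real.exp_add, Real.exp_log hc]
  calc ∑ k, Real.exp (β * inner ℝ x (u k))
      ≤ ∑ k : ι, Real.exp ((⨆ j, inner ℝ x (u j)) * β) := by
        refine Finset.sum_le_sum fun k _ => Real.exp_le_exp.2 ?_
        rw [mul_comm]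
        exact mul_le_mul_of_nonneg_right (le_iSup_fin (fun j => inner ℝ x (u j)) k) hβ.le
    _ = _ := by simp [mul_comm]

/-- The uniform probability measure on `(0, π / 2]`. -/
noncomputable def quarterTurn : Measure ℝ :=
  ENNReal.ofReal (2 / Real.pi) • volume.restrict (Set.Ioc 0 (Real.pi / 2))

instance : IsProbabilityMeasure quarterTurn := by
  refine ⟨?_⟩
  have := Real.pi_pos
  rw [quarterTurn, Measure.smul_apply, Measure.restrict_apply_univ, Real.volume_Ioc, smul_eq_mul,
    ← ENNReal.ofReal_mul (by positivity)]
  rw [show 2 / Real.pi * (Real.pi / 2 - 0) = 1 by field_simp; ring]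
  simp

theorem integrable_quarterTurn {f : ℝ → ℝ} (hf : Continuous f) : Integrable f quarterTurn :=
  Integrable.smul_measure hf.integrableOn_Ioc ENNReal.ofReal_ne_top

theorem integral_quarterTurn (f : ℝ → ℝ) :
    ∫ θ, f θ ∂quarterTurn = 2 / Real.pi * ∫ θ in (0 : ℝ)..(Real.pi / 2), f θ := by
  have := Real.pi_pos
  rw [quarterTurn, integral_smul_measure, intervalIntegral.integral_of_le (by positivity),
    ENNReal.toReal_ofReal (by positivity), smul_eq_mul]

/-- The fundamental theorem of calculus along the rotation from `p.1` to `p.2`: the derivative of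
the path is the second rotated component, and the gradient of the softmax is the weighted mean of
the `u j`. -/
theorem softMax_sub_eq_integral (u : ι → E) {β : ℝ} (hβ : 0 < β) (p : E × E) :
    softMax u β p.2 - softMax u β p.1 = Real.pi / 2 * ∫ θ, ∑ j,
      softWeight u β j (ContinuousLinearMap.rotation θ p).1 *
        inner ℝ (ContinuousLinearMap.rotation θ p).2 (u j) ∂quarterTurn := by
  have hpi := Real.pi_pos
  have hr : Continuous fun θ : ℝ => ContinuousLinearMap.rotation θ p := by
    simp_rw [ContinuousLinearMap.rotation_apply]; fun_prop
  have hd : ∀ θ : ℝ, HasDerivAt (fun θ => softMax u β (ContinuousLinearMap.rotation θ p).1)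
      (∑ j, softWeight u β j (ContinuousLinearMap.rotation θ p).1 *
        inner ℝ (ContinuousLinearMap.rotation θ p).2 (u j)) θ := by
    intro θ
    have h1 : ∀ j, HasDerivAt
        (fun θ : ℝ => inner ℝ (ContinuousLinearMap.rotation θ p).1 (u j))
        (inner ℝ (ContinuousLinearMap.rotation θ p).2 (u j)) θ := by
      intro j
      simp_rw [ContinuousLinearMap.rotation_apply, inner_add_left, real_inner_smul_left]
      exact ((Real.hasDerivAt_cos θ).mul_const _).add ((Real.hasDerivAt_sin θ).mul_const _)
    have h2 : HasDerivAt (fun θ : ℝ => ∑ j,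
        Real.exp (β * inner ℝ (ContinuousLinearMap.rotation θ p).1 (u j))) _ θ :=
      HasDerivAt.fun_sum fun j _ => ((h1 j).const_mul β).exp
    have h3 := (h2.log (sum_exp_pos u β _).ne').div_const β
    refine h3.congr_deriv ?_
    rw [Finset.sum_div, Finset.sum_div]
    refine Finset.sum_congr rfl fun j _ => ?_
    rw [softWeight]
    have := (sum_exp_pos u β (ContinuousLinearMap.rotation θ p).1).ne'
    field_simp
  have hc : Continuous fun θ : ℝ => ∑ j, softWeight u β j (ContinuousLinearMap.rotation θ p).1 *
      inner ℝ (ContinuousLinearMap.rotation θ p).2 (u j) := by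
    refine continuous_finsetSum _ fun j _ => ?_
    exact ((continuous_softWeight u β j).comp (continuous_fst.comp hr)).mul (by fun_prop)
  have h := intervalIntegral.integral_eq_sub_of_hasDerivAt (a := 0) (b := Real.pi / 2)
    (fun θ _ => hd θ) (hc.intervalIntegrable _ _)
  rw [integral_quarterTurn, h, ← mul_assoc,
    show Real.pi / 2 * (2 / Real.pi) = 1 by field_simp, one_mul]
  simp [ContinuousLinearMap.rotation_apply]

/-- Jensen's inequality is applied twice, to the uniform measure on angles and to the softmax
weights. The exponential then meets only single linear functionals, so the number of indices costs
nothing. -/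
theorem exp_softMax_sub_le (u : ι → E) {β : ℝ} (hβ : 0 < β) (s : ℝ) (p : E × E) :
    Real.exp (s * (softMax u β p.2 - softMax u β p.1)) ≤ ∫ θ, ∑ j,
      softWeight u β j (ContinuousLinearMap.rotation θ p).1 *
        Real.exp (s * (Real.pi / 2) * inner ℝ (ContinuousLinearMap.rotation θ p).2 (u j))
          ∂quarterTurn := by
  have hr : Continuous fun θ : ℝ => ContinuousLinearMap.rotation θ p := by
    simp_rw [ContinuousLinearMap.rotation_apply]; fun_prop
  have hw : ∀ j, Continuous fun θ : ℝ =>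
      softWeight u β j (ContinuousLinearMap.rotation θ p).1 := fun j =>
    (continuous_softWeight u β j).comp (continuous_fst.comp hr)
  have hc : Continuous fun θ : ℝ => s * (Real.pi / 2) *
      ∑ j, softWeight u β j (ContinuousLinearMap.rotation θ p).1 *
        inner ℝ (ContinuousLinearMap.rotation θ p).2 (u j) :=
    continuous_const.mul <| continuous_finsetSum _ fun j _ => (hw j).mul (by fun_prop)
  rw [softMax_sub_eq_integral u hβ p, ← mul_assoc, ← integral_const_mul]
  refine (convexOn_exp.map_integral_le Real.continuous_exp.continuousOn isClosed_univ
    (by simp) (integrable_quarterTurn hc)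
    (integrable_quarterTurn (Real.continuous_exp.comp hc))).trans ?_
  refine integral_mono (integrable_quarterTurn (Real.continuous_exp.comp hc))
    (integrable_quarterTurn <| continuous_finsetSum _ fun j _ => (hw j).mul (by fun_prop)) ?_
  intro θ
  have := convexOn_exp.map_sum_le (t := Finset.univ)
    (w := fun j => softWeight u β j (ContinuousLinearMap.rotation θ p).1)
    (p := fun j => s * (Real.pi / 2) * inner ℝ (ContinuousLinearMap.rotation θ p).2 (u j))
    (fun j _ => softWeight_nonneg _ _ _ _) (sum_softWeight _ _ _) (fun _ _ => Set.mem_univ _)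
  simp only [smul_eq_mul] at this
  refine le_trans (le_of_eq ?_) this
  dsimp only
  rw [Finset.mul_sum]
  congr 1
  exact Finset.sum_congr rfl fun j _ => by ring

variable [FiniteDimensional ℝ E] [MeasurableSpace E] [BorelSpace E]

theorem integrable_exp_inner_stdGaussian (t : ℝ) (u : E) :
    Integrable (fun x => Real.exp (t * inner ℝ x u)) (stdGaussian E) := by
  have h := integrable_exp_mul_gaussianReal (μ := 0) (v := ‖u‖₊ ^ 2) t
  rw [← stdGaussian_map_inner u] at h
  exact (integrable_map_measure (f := fun x : E => inner ℝ x u) (g := fun y => Real.exp (t * y))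
    (by fun_prop) (by fun_prop)).1 h

theorem integral_exp_inner_stdGaussian_le (t : ℝ) {u : E} (hu : ‖u‖ ≤ 1) :
    ∫ x, Real.exp (t * inner ℝ x u) ∂(stdGaussian E) ≤ Real.exp (t ^ 2 / 2) := by
  have h := mgf_gaussianReal (stdGaussian_map_inner u) t
  rw [mgf] at h
  rw [h]
  apply Real.exp_le_exp.2
  have : ‖u‖ ^ 2 ≤ 1 := by nlinarith [norm_nonneg u]
  push_cast
  nlinarith [sq_nonneg t]

theorem lintegral_exp_softMax_sub_le {u : ι → E} (hu : ∀ j, ‖u j‖ ≤ 1) {β : ℝ} (hβ : 0 < β)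
    (s : ℝ) :
    ∫⁻ p : E × E, ENNReal.ofReal (Real.exp (s * (softMax u β p.2 - softMax u β p.1)))
      ∂((stdGaussian E).prod (stdGaussian E)) ≤
      ENNReal.ofReal (Real.exp (Real.pi ^ 2 * s ^ 2 / 8)) := by
  set γ := stdGaussian E
  set G : E × E → ℝ := fun q => ∑ j, softWeight u β j q.1 *
    Real.exp (s * (Real.pi / 2) * inner ℝ q.2 (u j)) with hG
  have hGc : Continuous G := continuous_finsetSum _ fun j _ =>
    ((continuous_softWeight u β j).comp continuous_fst).mul (by fun_prop)
  have hG0 : ∀ q, 0 ≤ G q := fun q => Finset.sum_nonneg fun j _ =>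
    mul_nonneg (softWeight_nonneg _ _ _ _) (Real.exp_pos _).le
  have hrot : Continuous fun z : (E × E) × ℝ => ContinuousLinearMap.rotation z.2 z.1 := by
    simp_rw [ContinuousLinearMap.rotation_apply]; fun_prop
  have hGr : ∀ p : E × E, Continuous fun θ : ℝ => G (ContinuousLinearMap.rotation θ p) := by
    intro p
    have h : Continuous fun θ : ℝ => ContinuousLinearMap.rotation θ p := by
      simp_rw [ContinuousLinearMap.rotation_apply]; fun_prop
    exact hGc.comp h
  have hGm : Measurable fun z : (E × E) × ℝ =>
      ENNReal.ofReal (G (ContinuousLinearMap.rotation z.2 z.1)) :=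
    (hGc.comp hrot).measurable.ennreal_ofReal
  have hw : ∀ j, Integrable (softWeight u β j) γ := fun j =>
    Integrable.of_bound (continuous_softWeight u β j).aestronglyMeasurable 1
      (.of_forall fun x => by
        rw [Real.norm_eq_abs, abs_of_nonneg (softWeight_nonneg _ _ _ _)]
        exact softWeight_le_one _ _ _ _)
  have hi : ∀ j, Integrable (fun q : E × E => softWeight u β j q.1 *
      Real.exp (s * (Real.pi / 2) * inner ℝ q.2 (u j))) (γ.prod γ) := fun j =>
    (hw j).mul_prod (integrable_exp_inner_stdGaussian _ _)
  calc _ ≤ ∫⁻ p : E × E, ∫⁻ θ, ENNReal.ofReal (G (ContinuousLinearMap.rotation θ p))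
        ∂quarterTurn ∂(γ.prod γ) := by
        refine lintegral_mono fun p => ?_
        rw [← ofReal_integral_eq_lintegral_ofReal
          (f := fun θ => G (ContinuousLinearMap.rotation θ p))
          (integrable_quarterTurn (hGr p))
          (.of_forall fun _ => hG0 _)]
        exact ENNReal.ofReal_le_ofReal (exp_softMax_sub_le u hβ s p)
    _ = ∫⁻ θ, ∫⁻ p : E × E, ENNReal.ofReal (G (ContinuousLinearMap.rotation θ p))
        ∂(γ.prod γ) ∂quarterTurn :=
        lintegral_lintegral_swap hGm.aemeasurable
    -- A pair of independent standard Gaussian vectors is invariant under rotation. The weights and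
    -- the exponentials thus become functions of independent components.
    _ = ∫⁻ θ, ∫⁻ p : E × E, ENNReal.ofReal (G p) ∂(γ.prod γ) ∂quarterTurn := by
        refine lintegral_congr fun θ => ?_
        have hmp : MeasurePreserving (ContinuousLinearMap.rotation θ : E × E →L[ℝ] E × E)
            (γ.prod γ) (γ.prod γ) :=
          ⟨(ContinuousLinearMap.continuous _).measurable,
            IsGaussian.map_rotation_eq_self (by simp [γ]) θ⟩
        exact hmp.lintegral_comp (f := fun q => ENNReal.ofReal (G q)) hGc.measurable.ennreal_ofReal
    _ = ENNReal.ofReal (∫ p, G p ∂(γ.prod γ)) := by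
        rw [lintegral_const, measure_univ, mul_one, ofReal_integral_eq_lintegral_ofReal
          (integrable_finsetSum _ fun j _ => hi j) (.of_forall hG0)]
    _ ≤ _ := by
        refine ENNReal.ofReal_le_ofReal ?_
        rw [integral_finsetSum _ fun j _ => hi j]
        calc _ = ∑ j, (∫ x, softWeight u β j x ∂γ) *
              ∫ x, Real.exp (s * (Real.pi / 2) * inner ℝ x (u j)) ∂γ :=
              Finset.sum_congr rfl fun j _ => integral_prod_mul _ _
          _ ≤ ∑ j, (∫ x, softWeight u β j x ∂γ) * Real.exp ((s * (Real.pi / 2)) ^ 2 / 2) :=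
              Finset.sum_le_sum fun j _ => mul_le_mul_of_nonneg_left
                (integral_exp_inner_stdGaussian_le _ (hu j))
                (integral_nonneg fun x => softWeight_nonneg _ _ _ _)
          _ = _ := by
              rw [← Finset.sum_mul, ← integral_finsetSum _ fun j _ => hw j]
              simp_rw [sum_softWeight]
              simp only [integral_const, probReal_univ, smul_eq_mul, one_mul]
              congr 1; ring

/-- Gaussian concentration for finite suprema of linear functionals of norm at most one. -/
theorem lintegral_exp_iSup_inner_le {u : ι → E} (hu : ∀ j, ‖u j‖ ≤ 1) {s : ℝ} (hs : 0 ≤ s) :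
    ∫⁻ x, ENNReal.ofReal (Real.exp (s * ⨆ j, inner ℝ x (u j))) ∂(stdGaussian E) ≤
      ENNReal.ofReal (Real.exp (s * ∫ x, ⨆ j, inner ℝ x (u j) ∂(stdGaussian E)
        + Real.pi ^ 2 * s ^ 2 / 8)) := by
  set γ := stdGaussian E
  set m := ∫ x, ⨆ j, inner ℝ x (u j) ∂γ with hm
  set l := Real.log (Fintype.card ι)
  have hsup : Integrable (fun x => ⨆ j, inner ℝ x (u j)) γ :=
    integrable_iSup fun j => integrable_inner_stdGaussian (u j)
  have key : ∀ β : ℝ, 0 < β →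
      ∫⁻ x, ENNReal.ofReal (Real.exp (s * ⨆ j, inner ℝ x (u j))) ∂γ ≤
      ENNReal.ofReal (Real.exp (s * (m + l / β) + Real.pi ^ 2 * s ^ 2 / 8)) := by
    intro β hβ
    have hFi : Integrable (softMax u β) γ := by
      refine Integrable.mono' (hsup.abs.add (hsup.add (integrable_const (l / β))).abs)
        (continuous_softMax u β).aestronglyMeasurable (.of_forall fun x => ?_)
      simp only [Pi.add_apply, Real.norm_eq_abs]
      have h1 := iSup_le_softMax u hβ x
      have h2 := softMax_le_iSup u hβ x
      rw [abs_le]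
      constructor
      · linarith [neg_abs_le (⨆ j, inner ℝ x (u j)),
          abs_nonneg ((⨆ j, inner ℝ x (u j)) + l / β)]
      · linarith [le_abs_self ((⨆ j, inner ℝ x (u j)) + l / β),
          abs_nonneg (⨆ j, inner ℝ x (u j))]
    have hFm : ∫ x, softMax u β x ∂γ ≤ m + l / β := by
      refine (integral_mono hFi (hsup.add (integrable_const (l / β)))
        fun x => softMax_le_iSup u hβ x).trans (le_of_eq ?_)
      simp only [Pi.add_apply]
      rw [integral_add hsup (integrable_const _)]
      simp [hm]
    have hexpi : Integrable (fun y => Real.exp (-s * softMax u β y)) γ := by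
      obtain ⟨j⟩ := ‹Nonempty ι›
      refine Integrable.mono' (integrable_exp_inner_stdGaussian (-s) (u j))
        (Real.continuous_exp.comp
          (continuous_const.mul (continuous_softMax u β))).aestronglyMeasurable
        (.of_forall fun x => ?_)
      rw [Real.norm_eq_abs, abs_of_pos (Real.exp_pos _)]
      apply Real.exp_le_exp.2
      have h1 := (le_iSup_fin (fun j => inner ℝ x (u j)) j).trans (iSup_le_softMax u hβ x)
      nlinarith
    -- Jensen's inequality lets an independent copy replace the mean of the softmax, which reduces
    -- the claim to the difference of two copies.
    have hJ : Real.exp (-s * ∫ y, softMax u β y ∂γ) ≤ ∫ y, Real.exp (-s * softMax u β y) ∂γ := by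
      rw [← integral_const_mul]
      exact convexOn_exp.map_integral_le Real.continuous_exp.continuousOn isClosed_univ
        (by simp) (hFi.const_mul _) hexpi
    have hpt : ∀ x, ENNReal.ofReal (Real.exp (s * ⨆ j, inner ℝ x (u j))) ≤
        ENNReal.ofReal (Real.exp (s * (m + l / β))) *
        ∫⁻ y, ENNReal.ofReal (Real.exp (s * (softMax u β x - softMax u β y))) ∂γ := by
      intro x
      have h1 : ∀ y, Real.exp (s * (softMax u β x - softMax u β y))
          = Real.exp (s * softMax u β x) * Real.exp (-s * softMax u β y) := fun y => by
        rw [← Real.exp_add]; ring_nf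
      simp_rw [h1]
      rw [← ofReal_integral_eq_lintegral_ofReal (hexpi.const_mul _)
        (.of_forall fun y => by positivity), integral_const_mul,
        ← ENNReal.ofReal_mul (Real.exp_pos _).le]
      refine ENNReal.ofReal_le_ofReal ?_
      calc Real.exp (s * ⨆ j, inner ℝ x (u j)) ≤ Real.exp (s * (m + l / β)) *
            (Real.exp (s * softMax u β x) * Real.exp (-s * ∫ y, softMax u β y ∂γ)) := by
            rw [← Real.exp_add, ← Real.exp_add]
            apply Real.exp_le_exp.2
            nlinarith [mul_le_mul_of_nonneg_left hFm hs,
              mul_le_mul_of_nonneg_left (iSup_le_softMax u hβ x) hs]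
        _ ≤ _ := by gcongr
    have hmeas : Measurable fun p : E × E =>
        ENNReal.ofReal (Real.exp (s * (softMax u β p.2 - softMax u β p.1))) := by
      have := continuous_softMax u β
      exact (ENNReal.continuous_ofReal.comp (Real.continuous_exp.comp (by fun_prop))).measurable
    calc _ ≤ ∫⁻ x, ENNReal.ofReal (Real.exp (s * (m + l / β))) *
        ∫⁻ y, ENNReal.ofReal (Real.exp (s * (softMax u β x - softMax u β y))) ∂γ ∂γ :=
          lintegral_mono hpt
      _ = ENNReal.ofReal (Real.exp (s * (m + l / β))) * ∫⁻ p : E × E,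
          ENNReal.ofReal (Real.exp (s * (softMax u β p.2 - softMax u β p.1))) ∂(γ.prod γ) := by
          rw [lintegral_const_mul' _ _ ENNReal.ofReal_ne_top, lintegral_prod_symm' _ hmeas]
      _ ≤ ENNReal.ofReal (Real.exp (s * (m + l / β))) *
          ENNReal.ofReal (Real.exp (Real.pi ^ 2 * s ^ 2 / 8)) :=
          mul_le_mul_right (lintegral_exp_softMax_sub_le hu hβ s) _
      _ = _ := by rw [← ENNReal.ofReal_mul (Real.exp_pos _).le, ← Real.exp_add]
  -- The softmax exceeds the supremum by at most `l / β`, which disappears as `β` tends to infinity.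
  have hlim : Filter.Tendsto (fun β : ℝ => ENNReal.ofReal
      (Real.exp (s * (m + l / β) + Real.pi ^ 2 * s ^ 2 / 8))) Filter.atTop
      (nhds (ENNReal.ofReal (Real.exp (s * (m + 0) + Real.pi ^ 2 * s ^ 2 / 8)))) := by
    refine (ENNReal.continuous_ofReal.tendsto _).comp ((Real.continuous_exp.tendsto _).comp ?_)
    exact (((tendsto_const_nhds.add
      (Filter.Tendsto.const_div_atTop Filter.tendsto_id l)).const_mul s).add_const _)
  rw [add_zero] at hlim
  exact ge_of_tendsto hlim ((Filter.eventually_gt_atTop 0).mono key)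

end Concentration

theorem measure_ge_le_ofReal_of_integral_le {α : Type*} [MeasurableSpace α] {P : Measure α}
    [IsFiniteMeasure P] {f : α → ℝ} (hf0 : 0 ≤ᵐ[P] f) (hf : Integrable f P) {I ε δ : ℝ}
    (hε : 0 < ε) (hI : ∫ x, f x ∂P ≤ I) (hδ : I ≤ ε * δ) :
    P {x | ε ≤ f x} ≤ ENNReal.ofReal δ := by
  have h := mul_meas_ge_le_integral_of_nonneg hf0 hf ε
  have h2 : P.real {x | ε ≤ f x} ≤ δ := by
    by_contra hc
    push Not at hc
    nlinarith
  rw [← ENNReal.ofReal_toReal (measure_ne_top P {x | ε ≤ f x})]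
  exact ENNReal.ofReal_le_ofReal h2

/-! ### Comparison with a Gaussian process by contraction -/

section Comparison

variable {E : Type*} [NormedAddCommGroup E] [InnerProductSpace ℝ E] [FiniteDimensional ℝ E]
  [MeasurableSpace E] [BorelSpace E] {ι : Type*} [Finite ι] [Nonempty ι]

/-- If `j` and `k` attain the two suprema on the left, only the increment `p j - p k` enters. It is
at most `|q j - q k|`, and the sign decides which of `j`, `k` to use in each supremum on the right.
-/
theorem iSup_add_iSup_contraction {p q c : ι → ℝ} (h : ∀ j k, |p j - p k| ≤ |q j - q k|) :
    (⨆ j, (c j + 2 * p j)) + (⨆ j, (c j - 2 * p j)) ≤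
      (⨆ j, (c j + 2 * q j)) + ⨆ j, (c j - 2 * q j) := by
  obtain ⟨j, hj⟩ := exists_eq_ciSup_of_finite (f := fun j => c j + 2 * p j)
  obtain ⟨k, hk⟩ := exists_eq_ciSup_of_finite (f := fun j => c j - 2 * p j)
  rw [← hj, ← hk]
  have h1 := (le_abs_self _).trans (h j k)
  have a1 := le_iSup_fin (fun j => c j + 2 * q j) j
  have a2 := le_iSup_fin (fun j => c j + 2 * q j) k
  have b1 := le_iSup_fin (fun j => c j - 2 * q j) j
  have b2 := le_iSup_fin (fun j => c j - 2 * q j) k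
  rcases abs_cases (q j - q k) with h2 | h2 <;> linarith

/-- One step of the comparison of a centred process that contracts the increments of a Gaussian
process with the Gaussian process itself. -/
theorem integral_iSup_centred_le (u : ι → E) {ψ : E → ι → ℝ}
    (hint : ∀ j, Integrable (fun x => ψ x j) (stdGaussian E))
    (hψ : ∀ x j k, |ψ x j - ψ x k| ≤ |inner ℝ x (u j) - inner ℝ x (u k)|) (c : ι → ℝ) :
    ∫ x, ⨆ j, (c j + (∫ y, ψ y j ∂(stdGaussian E) - ψ x j)) ∂(stdGaussian E) ≤
      ∫ x, ⨆ j, (c j + 2 * inner ℝ x (u j)) ∂(stdGaussian E) := by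
  set γ := stdGaussian E
  have hl : ∀ j, Integrable (fun x : E => inner ℝ x (u j)) γ := fun j =>
    integrable_inner_stdGaussian (u j)
  have i1 : Integrable (fun x => ⨆ j, (c j + 2 * ψ x j)) γ :=
    integrable_iSup fun j => (integrable_const _).add ((hint j).const_mul 2)
  have i2 : Integrable (fun x => ⨆ j, (c j - 2 * ψ x j)) γ :=
    integrable_iSup fun j => (integrable_const _).sub ((hint j).const_mul 2)
  have i3 : Integrable (fun x : E => ⨆ j, (c j + 2 * inner ℝ x (u j))) γ :=
    integrable_iSup fun j => (integrable_const _).add ((hl j).const_mul 2)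
  have i4 : Integrable (fun x : E => ⨆ j, (c j - 2 * inner ℝ x (u j))) γ :=
    integrable_iSup fun j => (integrable_const _).sub ((hl j).const_mul 2)
  have i5 : Integrable (fun x => ⨆ j, (c j + (∫ y, ψ y j ∂γ - ψ x j))) γ :=
    integrable_iSup fun j => (integrable_const _).add ((integrable_const _).sub (hint j))
  -- The symmetry of the Gaussian law plays the role of random signs.
  have hneg : ∫ x : E, ⨆ j, (c j - 2 * inner ℝ x (u j)) ∂γ
      = ∫ x : E, ⨆ j, (c j + 2 * inner ℝ x (u j)) ∂γ := by
    have hmp : MeasurePreserving (fun x : E => -x) γ γ := ⟨by fun_prop, stdGaussian_map_neg⟩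
    rw [← hmp.integral_comp (Homeomorph.neg E).measurableEmbedding]
    simp [inner_neg_left, sub_eq_add_neg]
  have hmean : ⨆ j, (c j + 2 * ∫ y, ψ y j ∂γ) ≤ ∫ x, ⨆ j, (c j + 2 * ψ x j) ∂γ := by
    refine ciSup_le fun j => ?_
    have : c j + 2 * ∫ y, ψ y j ∂γ = ∫ x, (c j + 2 * ψ x j) ∂γ := by
      rw [integral_add (integrable_const _) ((hint j).const_mul 2), integral_const_mul]
      simp
    rw [this]
    exact integral_mono ((integrable_const _).add ((hint j).const_mul 2)) i1
      fun x => le_iSup_fin (fun j => c j + 2 * ψ x j) j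
  -- Each centred term is the average of `c j + 2 E[ψ j]` and `c j - 2 ψ x j`; this is the origin of
  -- the factor 2.
  have hpt : ∀ x, ⨆ j, (c j + (∫ y, ψ y j ∂γ - ψ x j)) ≤
      2⁻¹ * ((∫ x, ⨆ j, (c j + 2 * ψ x j) ∂γ) + ⨆ j, (c j - 2 * ψ x j)) := by
    intro x
    refine ciSup_le fun j => ?_
    have h1 := (le_iSup_fin (fun j => c j + 2 * ∫ y, ψ y j ∂γ) j).trans hmean
    have h2 := le_iSup_fin (fun j => c j - 2 * ψ x j) j
    linarith
  have hA := integral_mono i5 (((integrable_const _).add i2).const_mul _) hpt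
  have hB := integral_mono (i1.add i2) (i3.add i4) fun x =>
    iSup_add_iSup_contraction (c := c) (hψ x)
  simp only [Pi.add_apply] at hA hB
  rw [integral_const_mul, integral_add (integrable_const _) i2] at hA
  rw [integral_add i1 i2, integral_add i3 i4, hneg] at hB
  simp only [integral_const, probReal_univ, smul_eq_mul, one_mul] at hA
  linarith

/-- Comparison of the expected supremum of a centred empirical process that contracts the
increments of a Gaussian process with that of the Gaussian process. -/
theorem integral_iSup_sum_centred_le (u : ι → E) {ψ : E → ι → ℝ}
    (hint : ∀ j, Integrable (fun x => ψ x j) (stdGaussian E))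
    (hψ : ∀ x j k, |ψ x j - ψ x k| ≤ |inner ℝ x (u j) - inner ℝ x (u k)|) (m : ℕ) (c : ι → ℝ) :
    ∫ a, ⨆ j, (c j + ∑ i, (∫ y, ψ y j ∂(stdGaussian E) - ψ (a i) j))
        ∂(Measure.pi fun _ : Fin m => stdGaussian E) ≤
      ∫ a, ⨆ j, (c j + ∑ i, 2 * inner ℝ (a i) (u j))
        ∂(Measure.pi fun _ : Fin m => stdGaussian E) := by
  induction m generalizing c with
  | zero => simp
  | succ m ih =>
    set γ := stdGaussian E
    set Q := Measure.pi fun _ : Fin m => γ with hQ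
    have hl : ∀ j, Integrable (fun x : E => inner ℝ x (u j)) γ := fun j =>
      integrable_inner_stdGaussian (u j)
    set f : E → ι → ℝ := fun x j => ∫ y, ψ y j ∂γ - ψ x j with hf
    set g : E → ι → ℝ := fun x j => 2 * inner ℝ x (u j) with hg
    have hfi : ∀ j, Integrable (fun x => f x j) γ := fun j => (integrable_const _).sub (hint j)
    have hgi : ∀ j, Integrable (fun x => g x j) γ := fun j => (hl j).const_mul 2
    have hsum : ∀ {h : E → ι → ℝ}, (∀ j, Integrable (fun x => h x j) γ) → ∀ j,
        Integrable (fun a : Fin m → E => ∑ i, h (a i) j) Q := fun hh j =>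
      integrable_finsetSum _ fun i _ =>
        (measurePreserving_eval (fun _ : Fin m => γ) i).integrable_comp_of_integrable (hh j)
    have hmp := measurePreserving_piFinSuccAbove (fun _ : Fin (m + 1) => γ) 0
    have hsplit : ∀ h : E → ι → ℝ,
        ∫ a, ⨆ j, (c j + ∑ i, h (a i) j) ∂(Measure.pi fun _ : Fin (m + 1) => γ)
        = ∫ p : E × (Fin m → E), ⨆ j, (c j + (h p.1 j + ∑ i, h (p.2 i) j)) ∂(γ.prod Q) := by
      intro h
      rw [hQ, ← hmp.integral_comp (MeasurableEquiv.measurableEmbedding _)]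
      simp [Fin.sum_univ_succ, MeasurableEquiv.piFinSuccAbove, Fin.tail]
    have hpi : ∀ {h k : E → ι → ℝ}, (∀ j, Integrable (fun x => h x j) γ) →
        (∀ j, Integrable (fun x => k x j) γ) →
        Integrable (fun p : E × (Fin m → E) => ⨆ j, (c j + (h p.1 j + ∑ i, k (p.2 i) j)))
          (γ.prod Q) := fun hh hk =>
      integrable_iSup fun j => (integrable_const _).add (((hh j).comp_fst Q).add
        ((hsum hk j).comp_snd γ))
    rw [hsplit f, hsplit g, integral_prod _ (hpi hfi hfi)]
    -- The summands are replaced one at a time by Fubini. With one vector fixed, its contribution is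
    -- absorbed into `c`, which is why the statement allows an arbitrary shift.
    calc _ ≤ ∫ x, ∫ a, ⨆ j, (c j + (f x j + ∑ i, g (a i) j)) ∂Q ∂γ := by
          refine integral_mono (hpi hfi hfi).integral_prod_left (hpi hfi hgi).integral_prod_left
            fun x => ?_
          have := ih fun j => c j + f x j
          simpa only [add_assoc] using this
      _ = ∫ a, ∫ x, ⨆ j, (c j + (f x j + ∑ i, g (a i) j)) ∂γ ∂Q :=
          integral_integral_swap (hpi hfi hgi)
      _ ≤ ∫ a, ∫ x, ⨆ j, (c j + (g x j + ∑ i, g (a i) j)) ∂γ ∂Q := by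
          refine integral_mono (hpi hfi hgi).integral_prod_right
            (hpi hgi hgi).integral_prod_right fun a => ?_
          have := integral_iSup_centred_le u hint hψ fun j => c j + ∑ i, g (a i) j
          simp only [add_assoc] at this
          simpa only [hf, hg, add_comm (∑ i, _)] using this
      _ = _ := by
          rw [integral_prod_symm _ (hpi hgi hgi)]

/-- Uniform lower deviation bound for an empirical process that contracts the increments of a
Gaussian process. -/
theorem measure_exists_sum_centred_ge_le (u : ι → E) {ψ : E → ι → ℝ}
    (hint : ∀ j, Integrable (fun x => ψ x j) (stdGaussian E))
    (hψ : ∀ x j k, |ψ x j - ψ x k| ≤ |inner ℝ x (u j) - inner ℝ x (u k)|)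
    {j₀ : ι} (h₀ : ∀ x, ψ x j₀ = 0) {m : ℕ} (hm : 0 < m) {W θ δ : ℝ}
    (hW : ∫ x, ⨆ j, inner ℝ x (u j) ∂(stdGaussian E) ≤ W) (hθ : 0 < θ)
    (hWm : 2 * W ≤ θ * δ * Real.sqrt m) :
    (Measure.pi fun _ : Fin m => stdGaussian E)
      {a | ∃ j, θ * m ≤ ∑ i, (∫ y, ψ y j ∂(stdGaussian E) - ψ (a i) j)} ≤ ENNReal.ofReal δ := by
  have hm' : (0 : ℝ) < m := by exact_mod_cast hm
  set Z : (Fin m → E) → ℝ := fun a => ⨆ j, ∑ i, (∫ y, ψ y j ∂(stdGaussian E) - ψ (a i) j) with hZ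
  have hZi : Integrable Z (Measure.pi fun _ : Fin m => stdGaussian E) :=
    integrable_iSup fun j => integrable_finsetSum _ fun i _ =>
      (measurePreserving_eval (fun _ : Fin m => stdGaussian E) i).integrable_comp_of_integrable
        (g := fun x => ∫ y, ψ y j ∂(stdGaussian E) - ψ x j)
        ((integrable_const _).sub (hint j))
  -- The index at which the process vanishes makes the supremum nonnegative, as Markov's inequality
  -- requires.
  have hZ0 : ∀ a, 0 ≤ Z a := by
    intro a
    have := le_iSup_fin (fun j => ∑ i, (∫ y, ψ y j ∂(stdGaussian E) - ψ (a i) j)) j₀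
    refine le_trans (le_of_eq ?_) this
    simp [h₀]
  have hZI : ∫ a, Z a ∂(Measure.pi fun _ : Fin m => stdGaussian E) ≤ 2 * (Real.sqrt m * W) := by
    have h1 := integral_iSup_sum_centred_le u hint hψ m 0
    have h2 := integral_pi_iSup_inner_sum u (fun _ : Fin m => (1 : ℝ))
    simp only [one_smul, one_pow, Finset.sum_const, Finset.card_univ, Fintype.card_fin,
      nsmul_eq_mul, mul_one] at h2
    simp only [Pi.zero_apply, zero_add, ← Finset.mul_sum, ← sum_inner] at h1
    simp_rw [← Real.mul_iSup_of_nonneg zero_le_two] at h1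
    rw [integral_const_mul, h2] at h1
    refine h1.trans ?_
    gcongr
  refine (measure_mono ?_).trans (measure_ge_le_ofReal_of_integral_le
    (.of_forall hZ0) hZi (mul_pos hθ hm') hZI ?_)
  · rintro a ⟨j, hj⟩
    exact hj.trans (le_iSup_fin (fun j => ∑ i, (∫ y, ψ y j ∂(stdGaussian E) - ψ (a i) j)) j)
  · calc 2 * (Real.sqrt m * W) = Real.sqrt m * (2 * W) := by ring
      _ ≤ Real.sqrt m * (θ * δ * Real.sqrt m) :=
        mul_le_mul_of_nonneg_left hWm (Real.sqrt_nonneg m)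
      _ = θ * δ * (Real.sqrt m * Real.sqrt m) := by ring
      _ = θ * m * δ := by rw [Real.mul_self_sqrt hm'.le]; ring

end Comparison

/-! ### Uniform second moment bound -/

section Chevet

/-- The exponential moment `E[exp (g² / 4)]` of a standard Gaussian variable. -/
noncomputable def gaussianSqMoment : ℝ := ∫ x, Real.exp (x ^ 2 / 4) ∂(gaussianReal 0 1)

theorem integrable_exp_sq_gaussianReal :
    Integrable (fun x : ℝ => Real.exp (x ^ 2 / 4)) (gaussianReal 0 1) := by
  rw [gaussianReal_of_var_ne_zero _ one_ne_zero,
    integrable_withDensity_iff_integrable_smul' (measurable_gaussianPDF 0 1)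
      (.of_forall fun _ => gaussianPDF_lt_top)]
  have h : Integrable fun x : ℝ => (Real.sqrt (2 * Real.pi))⁻¹ * Real.exp (-(1 / 4) * x ^ 2) :=
    (integrable_exp_neg_mul_sq (by norm_num)).const_mul _
  refine h.congr (.of_forall fun x => ?_)
  simp only [toReal_gaussianPDF, gaussianPDFReal, smul_eq_mul, NNReal.coe_one, mul_one, sub_zero]
  rw [mul_assoc, ← Real.exp_add]
  ring_nf

theorem gaussianSqMoment_pos : 0 < gaussianSqMoment :=
  integral_exp_pos integrable_exp_sq_gaussianReal

theorem integral_exp_sum_sq_pi (m : ℕ) :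
    ∫⁻ d, ENNReal.ofReal (Real.exp ((∑ i, d i ^ 2) / 4))
      ∂(Measure.pi fun _ : Fin m => gaussianReal 0 1) = ENNReal.ofReal (gaussianSqMoment ^ m) := by
  have h : ∀ d : Fin m → ℝ, Real.exp ((∑ i, d i ^ 2) / 4) = ∏ i, Real.exp (d i ^ 2 / 4) := by
    intro d; rw [← Real.exp_sum, Finset.sum_div]
  simp_rw [h]
  rw [← ofReal_integral_eq_lintegral_ofReal
    (Integrable.fintype_prod fun _ => integrable_exp_sq_gaussianReal)
    (.of_forall fun d => Finset.prod_nonneg fun i _ => (Real.exp_pos _).le),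
    integral_fintype_prod_eq_prod (fun _ : Fin m => fun x : ℝ => Real.exp (x ^ 2 / 4))]
  simp [gaussianSqMoment]

theorem lintegral_exp_sum_mul_pi {m : ℕ} (v : Fin m → ℝ) :
    ∫⁻ d, ENNReal.ofReal (Real.exp (∑ i, v i * d i))
      ∂(Measure.pi fun _ : Fin m => gaussianReal 0 1)
      = ENNReal.ofReal (Real.exp ((∑ i, v i ^ 2) / 2)) := by
  simp_rw [Real.exp_sum]
  rw [← ofReal_integral_eq_lintegral_ofReal
    (Integrable.fintype_prod (f := fun i x => Real.exp (v i * x)) fun i =>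
      integrable_exp_mul_gaussianReal (v i))
    (.of_forall fun d => Finset.prod_nonneg fun i _ => (Real.exp_pos _).le),
    integral_fintype_prod_eq_prod (fun i : Fin m => fun x : ℝ => Real.exp (v i * x))]
  have h : ∀ i, ∫ x, Real.exp (v i * x) ∂(gaussianReal 0 1) = Real.exp (v i ^ 2 / 2) := by
    intro i
    have := mgf_gaussianReal (p := gaussianReal 0 1) (X := id) (μ := 0) (v := 1) (by simp) (v i)
    simpa [mgf] using this
  simp_rw [h, ← Real.exp_sum, Finset.sum_div]

variable {E : Type*} [NormedAddCommGroup E] [InnerProductSpace ℝ E] [FiniteDimensional ℝ E]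
  [MeasurableSpace E] [BorelSpace E] {ι : Type*} [Fintype ι] [Nonempty ι]

theorem lintegral_exp_norm_mul_iSup_le {u : ι → E} (hu : ∀ j, ‖u j‖ ≤ 1) {W : ℝ}
    (hW : ∫ x, ⨆ j, inner ℝ x (u j) ∂(stdGaussian E) ≤ W) {m : ℕ} (d : Fin m → ℝ) {l : ℝ}
    (hl : 0 ≤ l) (hl2 : l ^ 2 = 1 / 8) :
    ∫⁻ a, ENNReal.ofReal (Real.exp (l * ⨆ j, inner ℝ (∑ i, d i • a i) (u j)))
      ∂(Measure.pi fun _ : Fin m => stdGaussian E) ≤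
      ENNReal.ofReal (Real.exp (W ^ 2 / 2)) *
        ENNReal.ofReal (Real.exp ((∑ i, d i ^ 2) / 4)) := by
  have hc : Measurable fun x : E => ⨆ j, inner ℝ x (u j) := .iSup fun j => by fun_prop
  have hsum : Measurable fun a : Fin m → E => ∑ i, d i • a i := by fun_prop
  set r := Real.sqrt (∑ i, d i ^ 2) with hr
  have hr2 : r ^ 2 = ∑ i, d i ^ 2 := Real.sq_sqrt (Finset.sum_nonneg fun i _ => sq_nonneg _)
  have hr0 : 0 ≤ r := Real.sqrt_nonneg _
  rw [← lintegral_map (f := fun x : E => ENNReal.ofReal (Real.exp (l * ⨆ j, inner ℝ x (u j))))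
    (g := fun a : Fin m → E => ∑ i, d i • a i) (by fun_prop) hsum, pi_stdGaussian_map_sum_smul,
    lintegral_map (by fun_prop) (by fun_prop)]
  have hx : ∀ x : E, ⨆ j, inner ℝ (r • x) (u j) = r * ⨆ j, inner ℝ x (u j) := fun x => by
    simp only [real_inner_smul_left]
    rw [Real.mul_iSup_of_nonneg hr0]
  simp_rw [← hr, hx, ← mul_assoc]
  refine (lintegral_exp_iSup_inner_le hu (mul_nonneg hl hr0)).trans ?_
  rw [← ENNReal.ofReal_mul (Real.exp_pos _).le, ← Real.exp_add, ← hr2]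
  refine ENNReal.ofReal_le_ofReal (Real.exp_le_exp.2 ?_)
  have h1 := mul_le_mul_of_nonneg_left hW (mul_nonneg hl hr0)
  -- With l² = 1/8, the cross term is at most W²/2 + r²/16 and the concentration term at most
  -- 10r²/64, so together they stay below W²/2 + r²/4. The coefficient 1/4 < 1/2 keeps the
  -- exponential moment in `d` finite.
  have hpi : Real.pi ^ 2 ≤ 10 := by nlinarith [Real.pi_lt_d2, Real.pi_pos]
  have h2 : Real.pi ^ 2 * (l * r) ^ 2 ≤ 10 * (l * r) ^ 2 :=
    mul_le_mul_of_nonneg_right hpi (sq_nonneg _)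
  have h3 : (l * r) ^ 2 = r ^ 2 / 8 := by rw [mul_pow, hl2]; ring
  nlinarith [sq_nonneg (l * r - W), sq_nonneg r]

/-- Uniform upper bound for the quadratic form of a Gaussian matrix. -/
theorem measure_exists_sum_inner_sq_ge_le {u : ι → E} (hu : ∀ j, ‖u j‖ ≤ 1) {m : ℕ} (hm : 0 < m)
    {W δ : ℝ} (hδ : 0 < δ)
    (hW : ∫ x, ⨆ j, inner ℝ x (u j) ∂(stdGaussian E) ≤ W) (hWm : W ^ 2 ≤ m) :
    (Measure.pi fun _ : Fin m => stdGaussian E)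
      {a | ∃ j, 16 * (1 + gaussianSqMoment + 1 / δ) * m ≤ ∑ i, inner ℝ (a i) (u j) ^ 2}
      ≤ ENNReal.ofReal δ := by
  have hm' : (1 : ℝ) ≤ m := by exact_mod_cast hm
  set Q := Measure.pi fun _ : Fin m => stdGaussian E
  set D := Measure.pi fun _ : Fin m => gaussianReal 0 1
  set B := 1 + gaussianSqMoment + 1 / δ with hB
  obtain ⟨l, hl0, hl2⟩ : ∃ l : ℝ, 0 ≤ l ∧ l ^ 2 = 1 / 8 :=
    ⟨Real.sqrt (1 / 8), Real.sqrt_nonneg _, Real.sq_sqrt (by norm_num)⟩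
  have hmeas : Measurable fun p : (Fin m → E) × (Fin m → ℝ) =>
      ENNReal.ofReal (Real.exp (l * ⨆ j, inner ℝ (∑ i, p.2 i • p.1 i) (u j))) := by
    have : Measurable fun p : (Fin m → E) × (Fin m → ℝ) =>
        ⨆ j, inner ℝ (∑ i, p.2 i • p.1 i) (u j) := .iSup fun j => by fun_prop
    fun_prop
  set Φ : (Fin m → E) → ENNReal := fun a =>
    ∫⁻ d, ENNReal.ofReal (Real.exp (l * ⨆ j, inner ℝ (∑ i, d i • a i) (u j))) ∂D with hΦ
  have hΦm : Measurable Φ := hmeas.lintegral_prod_right'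
  have hΦI : ∫⁻ a, Φ a ∂Q ≤
      ENNReal.ofReal (Real.exp (W ^ 2 / 2) * gaussianSqMoment ^ m) := by
    rw [hΦ, lintegral_lintegral_swap hmeas.aemeasurable]
    refine (lintegral_mono fun d => lintegral_exp_norm_mul_iSup_le hu hW d hl0 hl2).trans ?_
    rw [lintegral_const_mul' _ _ ENNReal.ofReal_ne_top, integral_exp_sum_sq_pi,
      ENNReal.ofReal_mul (Real.exp_pos _).le]
  -- Gaussian linearization: exp of half a sum of squares is the mean of exp of a linear form in an
  -- independent Gaussian `d`, hence is bounded by `Φ`. The factor 16 cancels l²/2 = 1/16.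
  have hsub : {a : Fin m → E | ∃ j, 16 * B * m ≤ ∑ i, inner ℝ (a i) (u j) ^ 2} ⊆
      {a | ENNReal.ofReal (Real.exp (B * m)) ≤ Φ a} := by
    rintro a ⟨j, hj⟩
    have h1 := lintegral_exp_sum_mul_pi fun i => l * inner ℝ (a i) (u j)
    calc ENNReal.ofReal (Real.exp (B * m))
        ≤ ENNReal.ofReal (Real.exp ((∑ i, (l * inner ℝ (a i) (u j)) ^ 2) / 2)) := by
          refine ENNReal.ofReal_le_ofReal (Real.exp_le_exp.2 ?_)
          simp_rw [mul_pow, hl2, ← Finset.mul_sum]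
          linarith
      _ ≤ Φ a := by
          rw [← h1]
          refine lintegral_mono fun d => ENNReal.ofReal_le_ofReal (Real.exp_le_exp.2 ?_)
          have h2 := le_iSup_fin (fun j => inner ℝ (∑ i, d i • a i) (u j)) j
          refine le_trans (le_of_eq ?_) (mul_le_mul_of_nonneg_left h2 hl0)
          simp only [sum_inner, real_inner_smul_left]
          rw [Finset.mul_sum]
          exact Finset.sum_congr rfl fun i _ => by ring
  refine (measure_mono hsub).trans ((meas_ge_le_lintegral_div hΦm.aemeasurable
    (by simp [Real.exp_pos]) ENNReal.ofReal_ne_top).trans ?_)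
  refine (ENNReal.div_le_div_right hΦI _).trans ?_
  rw [← ENNReal.ofReal_div_of_pos (Real.exp_pos _)]
  refine ENNReal.ofReal_le_ofReal ?_
  rw [div_le_iff₀ (Real.exp_pos _)]
  have hK : gaussianSqMoment ^ m ≤ Real.exp (m * gaussianSqMoment) := by
    rw [Real.exp_nat_mul]
    exact pow_le_pow_left₀ gaussianSqMoment_pos.le
      ((by linarith [gaussianSqMoment_pos] :
        gaussianSqMoment ≤ gaussianSqMoment + 1).trans (Real.add_one_le_exp _)) m
  -- The summand 1/δ in `B` turns the exponential Markov bound into δ, using m ≥ 1.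
  have hδe : 1 ≤ δ * Real.exp (m / δ) := by
    have h1 : m / δ + 1 ≤ Real.exp (m / δ) := Real.add_one_le_exp _
    have h2 : 1 ≤ δ * (m / δ) := by rw [mul_div_cancel₀ _ hδ.ne']; exact hm'
    nlinarith
  calc Real.exp (W ^ 2 / 2) * gaussianSqMoment ^ m
      ≤ Real.exp m * Real.exp (m * gaussianSqMoment) := by
        refine mul_le_mul (Real.exp_le_exp.2 (by linarith)) hK
          (pow_nonneg gaussianSqMoment_pos.le m) (Real.exp_pos _).le
    _ ≤ Real.exp m * Real.exp (m * gaussianSqMoment) * (δ * Real.exp (m / δ)) :=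
        le_mul_of_one_le_right (by positivity) hδe
    _ = δ * Real.exp (B * m) := by
        rw [show B * m = m + m * gaussianSqMoment + m / δ by rw [hB]; ring, Real.exp_add,
          Real.exp_add]
        ring

end Chevet

/-! ### The multiplier process -/

section Multiplier

variable {E : Type*} [NormedAddCommGroup E] [InnerProductSpace ℝ E] [FiniteDimensional ℝ E]
  [MeasurableSpace E] [BorelSpace E] {ι : Type*} [Finite ι] [Nonempty ι]
  {Ξ : Type*} [MeasurableSpace Ξ] {ν : Measure Ξ} [IsProbabilityMeasure ν]

instance : IsProbabilityMeasure (scalarLaw ν) := by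
  unfold scalarLaw; infer_instance

/-- The measurement vector with component `p.1.1` along `x₀` and orthogonal component taken from
`p.2`, together with the seed `p.1.2`. -/
noncomputable def assemble (x₀ : E) (p : (ℝ × Ξ) × E) : E × Ξ :=
  (p.1.1 • x₀ + (p.2 - inner ℝ p.2 x₀ • x₀), p.1.2)

theorem measurePreserving_assemble {x₀ : E} (hx : ‖x₀‖ = 1) :
    MeasurePreserving (assemble (Ξ := Ξ) x₀) ((scalarLaw ν).prod (stdGaussian E))
      ((stdGaussian E).prod ν) := by
  have h1 : MeasurePreserving (fun p : ℝ × E => p.1 • x₀ + (p.2 - inner ℝ p.2 x₀ • x₀))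
      ((gaussianReal 0 1).prod (stdGaussian E)) (stdGaussian E) :=
    ⟨by fun_prop, prod_map_split_eq_stdGaussian hx⟩
  have h2 := (h1.prod (MeasurePreserving.id ν)).comp
    (((measurePreserving_prodAssoc (gaussianReal 0 1) (stdGaussian E) ν).symm _).comp
      (((MeasurePreserving.id (gaussianReal 0 1)).prod
        (Measure.measurePreserving_swap (μ := ν) (ν := stdGaussian E))).comp
        (measurePreserving_prodAssoc (gaussianReal 0 1) ν (stdGaussian E))))
  exact h2

/-- The inequality of arithmetic and geometric means; with r² the bound on the expected sum it
replaces Jensen's inequality for the square root. -/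
theorem sqrt_sum_sq_le {m : ℕ} (z : Fin m → ℝ) {r : ℝ} (hr : 0 < r) :
    Real.sqrt (∑ i, z i ^ 2) ≤ 2⁻¹ * (r + r⁻¹ * ∑ i, z i ^ 2) := by
  set q := Real.sqrt (∑ i, z i ^ 2)
  have hq : q ^ 2 = ∑ i, z i ^ 2 := Real.sq_sqrt (Finset.sum_nonneg fun i _ => sq_nonneg _)
  rw [← hq]
  have : r + r⁻¹ * q ^ 2 - 2 * q = r⁻¹ * (r - q) ^ 2 := by field_simp; ring
  have : 0 ≤ r⁻¹ * (r - q) ^ 2 := by positivity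
  linarith

/-- The orthogonal parts are independent of the multipliers. Conditionally on the latter, the sum is
a Gaussian vector scaled by their Euclidean norm, whose mean is at most √m M. -/
theorem integral_iSup_multiplier_le (u : ι → E) {x₀ : E} (hx : ‖x₀‖ = 1) {z : ℝ × Ξ → ℝ}
    (hz : MemLp z 2 (scalarLaw ν)) {M W : ℝ} (hM : 0 < M)
    (hzM : ∫ p, z p ^ 2 ∂(scalarLaw ν) ≤ M ^ 2) (hW0 : 0 ≤ W)
    (hW : ∫ x, ⨆ j, inner ℝ x (u j) ∂(stdGaussian E) ≤ W) {m : ℕ} (hm : 0 < m) :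
    Integrable (fun p : (Fin m → ℝ × Ξ) × (Fin m → E) =>
      ⨆ j, inner ℝ (∑ i, (-z (p.1 i)) • p.2 i) (u j - inner ℝ (u j) x₀ • x₀))
      ((Measure.pi fun _ => scalarLaw ν).prod (Measure.pi fun _ => stdGaussian E)) ∧
    ∫ p : (Fin m → ℝ × Ξ) × (Fin m → E),
      ⨆ j, inner ℝ (∑ i, (-z (p.1 i)) • p.2 i) (u j - inner ℝ (u j) x₀ • x₀)
      ∂((Measure.pi fun _ => scalarLaw ν).prod (Measure.pi fun _ => stdGaussian E))
      ≤ Real.sqrt m * M * W := by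
  have hm' : (0 : ℝ) < m := by exact_mod_cast hm
  set Q := Measure.pi fun _ : Fin m => stdGaussian E
  set D := Measure.pi fun _ : Fin m => scalarLaw ν
  have hint : Integrable (fun p : (Fin m → ℝ × Ξ) × (Fin m → E) =>
      ⨆ j, inner ℝ (∑ i, (-z (p.1 i)) • p.2 i) (u j - inner ℝ (u j) x₀ • x₀)) (D.prod Q) := by
    refine integrable_iSup fun j => ?_
    simp_rw [sum_inner, real_inner_smul_left]
    refine integrable_finsetSum _ fun i _ => ?_
    exact Integrable.mul_prod (f := fun w : Fin m → ℝ × Ξ => -z (w i))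
      (g := fun b : Fin m → E => inner ℝ (b i) (u j - inner ℝ (u j) x₀ • x₀))
      ((measurePreserving_eval (fun _ : Fin m => scalarLaw ν) i).integrable_comp_of_integrable
        (g := fun p => -z p) (hz.integrable one_le_two).neg)
      ((measurePreserving_eval (fun _ : Fin m => stdGaussian E) i).integrable_comp_of_integrable
        (g := fun x => inner ℝ x (u j - inner ℝ (u j) x₀ • x₀)) (integrable_inner_stdGaussian _))
  refine ⟨hint, ?_⟩
  have hW' : ∫ x, ⨆ j, inner ℝ x (u j - inner ℝ (u j) x₀ • x₀) ∂(stdGaussian E) ≤ W := by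
    refine le_trans (le_of_eq ?_) ((integral_iSup_inner_orthogonal_le u hx).trans hW)
    refine integral_congr_ae (.of_forall fun x => iSup_congr fun j => ?_)
    simp only [inner_sub_left, inner_sub_right, real_inner_smul_left, real_inner_smul_right,
      real_inner_comm x₀]
    ring
  set r := Real.sqrt m * M with hr
  have hr0 : 0 < r := mul_pos (Real.sqrt_pos.2 hm') hM
  have hr2 : r ^ 2 = m * M ^ 2 := by rw [hr, mul_pow, Real.sq_sqrt hm'.le]
  clear_value r
  have hz2 : ∀ i, Integrable (fun w : Fin m → ℝ × Ξ => z (w i) ^ 2) D := fun i =>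
    (measurePreserving_eval (fun _ : Fin m => scalarLaw ν) i).integrable_comp_of_integrable
      (g := fun p => z p ^ 2) hz.integrable_sq
  have hz2i : Integrable (fun w : Fin m → ℝ × Ξ =>
      2⁻¹ * (r + r⁻¹ * ∑ i, z (w i) ^ 2) * W) D :=
    (((integrable_const _).add
      ((integrable_finsetSum _ fun i _ => hz2 i).const_mul _)).const_mul _).mul_const _
  rw [integral_prod _ hint]
  refine (integral_mono hint.integral_prod_left hz2i fun w => ?_).trans ?_
  · dsimp only
    rw [integral_pi_iSup_inner_sum (fun j => u j - inner ℝ (u j) x₀ • x₀) fun i => -z (w i)]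
    simp only [neg_sq]
    exact (mul_le_mul_of_nonneg_left hW' (Real.sqrt_nonneg _)).trans
      (mul_le_mul_of_nonneg_right (sqrt_sum_sq_le _ hr0) hW0)
  · rw [integral_mul_const, integral_const_mul, integral_add (integrable_const _)
      ((integrable_finsetSum _ fun i _ => hz2 i).const_mul _), integral_const_mul,
      integral_finsetSum _ fun i _ => hz2 i]
    refine mul_le_mul_of_nonneg_right ?_ hW0
    have h1 : ∀ i, ∫ w : Fin m → ℝ × Ξ, z (w i) ^ 2 ∂D ≤ M ^ 2 := by
      intro i
      refine le_trans (le_of_eq ?_) hzM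
      exact integral_comp_eval (μ := fun _ : Fin m => scalarLaw ν) (i := i)
        hz.integrable_sq.aestronglyMeasurable
    have h2 : ∑ i, ∫ w : Fin m → ℝ × Ξ, z (w i) ^ 2 ∂D ≤ r ^ 2 := by
      refine (Finset.sum_le_sum fun i _ => h1 i).trans (le_of_eq ?_)
      simp [hr2]
    have h3 : r⁻¹ * ∑ i, ∫ w : Fin m → ℝ × Ξ, z (w i) ^ 2 ∂D ≤ r⁻¹ * r ^ 2 :=
      mul_le_mul_of_nonneg_left h2 (by positivity)
    have h4 : r⁻¹ * r ^ 2 = r := by field_simp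
    simp only [integral_const, probReal_univ, smul_eq_mul, one_mul]
    linarith

/-- Chebyshev's inequality for a sum of independent copies of a centred variable. -/
theorem measure_abs_sum_pi_ge_le {α : Type*} [MeasurableSpace α] {ρ : Measure α}
    [IsProbabilityMeasure ρ] {X : α → ℝ} (hX : MemLp X 2 ρ) (hX0 : ∫ p, X p ∂ρ = 0) {M : ℝ}
    (hM : 0 < M) (hXM : ∫ p, X p ^ 2 ∂ρ ≤ M ^ 2) {m : ℕ} (hm : 0 < m) {k : ℝ} (hk : 0 < k) :
    (Measure.pi fun _ : Fin m => ρ) {w | k * (Real.sqrt m * M) ≤ |∑ i, X (w i)|} ≤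
      ENNReal.ofReal (1 / k ^ 2) := by
  have hm' : (0 : ℝ) < m := by exact_mod_cast hm
  have hXi : ∀ i, MemLp (fun w : Fin m → α => X (w i)) 2 (Measure.pi fun _ : Fin m => ρ) :=
    fun i => hX.comp_measurePreserving (measurePreserving_eval (fun _ : Fin m => ρ) i)
  have hS : MemLp (∑ i, fun w : Fin m → α => X (w i)) 2 (Measure.pi fun _ : Fin m => ρ) :=
    memLp_finsetSum' _ fun i _ => hXi i
  have hmean : ∫ w, (∑ i, fun w : Fin m → α => X (w i)) w ∂(Measure.pi fun _ : Fin m => ρ) = 0 := by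
    simp_rw [Finset.sum_apply]
    rw [integral_finsetSum _ fun i _ => (hXi i).integrable one_le_two]
    refine Finset.sum_eq_zero fun i _ => ?_
    rw [← hX0]
    exact integral_comp_eval (μ := fun _ : Fin m => ρ) (i := i) hX.aestronglyMeasurable
  have hvar : Var[∑ i, fun w : Fin m → α => X (w i); Measure.pi fun _ : Fin m => ρ]
      ≤ m * M ^ 2 := by
    rw [variance_sum_pi (μ := fun _ : Fin m => ρ) (X := fun _ => X) fun _ => hX]
    have : Var[X; ρ] ≤ M ^ 2 := by
      rw [variance_of_integral_eq_zero hX.aestronglyMeasurable.aemeasurable hX0]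
      exact hXM
    simpa using mul_le_mul_of_nonneg_left this hm'.le
  have h := meas_ge_le_variance_div_sq hS (c := k * (Real.sqrt m * M)) (by positivity)
  rw [hmean] at h
  simp only [sub_zero, Finset.sum_apply] at h
  refine h.trans (ENNReal.ofReal_le_ofReal ?_)
  rw [mul_pow, mul_pow, Real.sq_sqrt hm'.le, div_le_div_iff₀ (by positivity) (by positivity)]
  nlinarith [mul_le_mul_of_nonneg_right hvar (sq_nonneg k)]

/-- Uniform lower bound for the multiplier process. -/
theorem measure_exists_multiplier_le {u : ι → E} (hu : ∀ j, ‖u j‖ ≤ 1) {j₀ : ι} (h₀ : u j₀ = 0)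
    {x₀ : E} (hx : ‖x₀‖ = 1) {z : ℝ × Ξ → ℝ} (hzm : Measurable z)
    (hz : MemLp z 2 (scalarLaw ν)) (hzg : MemLp (fun p => z p * p.1) 2 (scalarLaw ν))
    (hmean : ∫ p, z p * p.1 ∂(scalarLaw ν) = 0) {M W δ : ℝ} (hM : 0 < M)
    (hzM : ∫ p, z p ^ 2 ∂(scalarLaw ν) ≤ M ^ 2)
    (hzgM : ∫ p, z p ^ 2 * p.1 ^ 2 ∂(scalarLaw ν) ≤ M ^ 2) (hW0 : 0 < W) (hδ : 0 < δ)
    (hW : ∫ x, ⨆ j, inner ℝ x (u j) ∂(stdGaussian E) ≤ W) {m : ℕ} (hm : 0 < m) :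
    (Measure.pi fun _ : Fin m => (stdGaussian E).prod ν)
      {q | ∃ j, ∑ i, z (inner ℝ (q i).1 x₀, (q i).2) * inner ℝ (q i).1 (u j) <
        -((1 + 2 / δ) * (Real.sqrt m * M) * (W + 1))} ≤ ENNReal.ofReal δ := by
  have hm' : (0 : ℝ) < m := by exact_mod_cast hm
  set r := Real.sqrt m * M with hr
  have hr0 : 0 < r := mul_pos (Real.sqrt_pos.2 hm') hM
  set Q := Measure.pi fun _ : Fin m => stdGaussian E
  set D := Measure.pi fun _ : Fin m => scalarLaw ν
  -- This makes both 1/k² ≤ δ/2 (Chebyshev, parallel part) and k δ/2 ≥ 1 (Markov, orthogonal part).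
  set k := 1 + 2 / δ with hk
  have hk1 : 0 < k := by positivity
  set A := {w : Fin m → ℝ × Ξ | k * r ≤ |∑ i, z (w i) * (w i).1|} with hA
  have hDA : D A ≤ ENNReal.ofReal (δ / 2) := by
    refine (measure_abs_sum_pi_ge_le hzg hmean hM (by simpa only [mul_pow] using hzgM)
      hm hk1).trans (ENNReal.ofReal_le_ofReal ?_)
    rw [div_le_div_iff₀ (by positivity) two_pos, hk]
    have : δ * (1 + 2 / δ) ^ 2 = δ + 4 + 4 / δ := by field_simp; ring
    have : 0 < 4 / δ := by positivity
    linarith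
  obtain ⟨hZi, hZI⟩ := integral_iSup_multiplier_le u hx hz hM hzM hW0.le hW hm
  set Z : (Fin m → ℝ × Ξ) × (Fin m → E) → ℝ := fun p =>
    ⨆ j, inner ℝ (∑ i, (-z (p.1 i)) • p.2 i) (u j - inner ℝ (u j) x₀ • x₀) with hZ
  have hZ0 : ∀ p, 0 ≤ Z p := by
    intro p
    have := le_iSup_fin (fun j => inner ℝ (∑ i, (-z (p.1 i)) • p.2 i)
      (u j - inner ℝ (u j) x₀ • x₀)) j₀
    refine le_trans (le_of_eq ?_) this
    simp [h₀]
  have hDZ : (D.prod Q) {p | k * r * W ≤ Z p} ≤ ENNReal.ofReal (δ / 2) := by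
    refine measure_ge_le_ofReal_of_integral_le (.of_forall hZ0) hZi (by positivity) hZI ?_
    have : k * r * W * (δ / 2) = r * W * (δ / 2 + 1) := by rw [hk]; field_simp
    rw [this]
    exact le_mul_of_one_le_right (by positivity) (by linarith)
  have hmp := (measurePreserving_pi (fun _ : Fin m => (scalarLaw ν).prod (stdGaussian E))
    (fun _ : Fin m => (stdGaussian E).prod ν)
    (fun _ => measurePreserving_assemble (ν := ν) hx))
  have hmp2 := (measurePreserving_arrowProdEquivProdArrow (ℝ × Ξ) E (Fin m)
    (fun _ => scalarLaw ν) (fun _ => stdGaussian E)).symm _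
  have hmp3 := hmp.comp hmp2
  have hmeas : MeasurableSet {q : Fin m → E × Ξ | ∃ j,
      ∑ i, z (inner ℝ (q i).1 x₀, (q i).2) * inner ℝ (q i).1 (u j) < -(k * r * (W + 1))} := by
    simp only [Set.ofPred_exists]
    refine MeasurableSet.iUnion fun j => measurableSet_lt ?_ measurable_const
    fun_prop
  rw [← hmp3.measure_preimage hmeas.nullMeasurableSet]
  calc _ ≤ (D.prod Q) (A ×ˢ Set.univ ∪ {p | k * r * W ≤ Z p}) := by
        refine measure_mono ?_
        rintro ⟨w, b⟩ ⟨j, hj⟩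
        by_contra hc
        simp only [hA, Set.mem_union, Set.mem_prod, Set.mem_ofPred_eq, Set.mem_univ, and_true,
          not_or, not_le] at hc
        obtain ⟨hc1, hc2⟩ := hc
        have h1 := (le_iSup_fin (fun j => inner ℝ (∑ i, (-z (w i)) • b i)
          (u j - inner ℝ (u j) x₀ • x₀)) j).trans_lt hc2
        have h2 : |inner ℝ x₀ (u j)| ≤ 1 := by
          refine (abs_real_inner_le_norm _ _).trans ?_
          rw [hx, one_mul]; exact hu j
        have h3 : |(∑ i, z (w i) * (w i).1) * inner ℝ x₀ (u j)| ≤ k * r := by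
          rw [abs_mul]
          exact (mul_le_of_le_one_right (abs_nonneg _) h2).trans hc1.le
        -- The sum splits into a scalar sum along `x₀`, centred and with second moments bounded
        -- through η, and the orthogonal process. The sign is put on `z` because a lower bound is
        -- wanted.
        have h4 : ∑ i, z (inner ℝ (assemble x₀ (w i, b i)).1 x₀, (assemble x₀ (w i, b i)).2) *
            inner ℝ (assemble x₀ (w i, b i)).1 (u j)
            = (∑ i, z (w i) * (w i).1) * inner ℝ x₀ (u j)
              - inner ℝ (∑ i, (-z (w i)) • b i) (u j - inner ℝ (u j) x₀ • x₀) := by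
          rw [sum_inner, Finset.sum_mul, ← Finset.sum_sub_distrib]
          refine Finset.sum_congr rfl fun i _ => ?_
          have h5 : inner ℝ (assemble x₀ (w i, b i)).1 x₀ = (w i).1 := by
            simp only [assemble, inner_add_left, inner_sub_left, real_inner_smul_left,
              real_inner_self_eq_norm_sq, hx]
            ring
          rw [h5]
          simp only [assemble, inner_add_left, inner_sub_left, inner_sub_right,
            real_inner_smul_left, real_inner_smul_right, real_inner_comm x₀]
          ring
        change ∑ i, z (inner ℝ (assemble x₀ (w i, b i)).1 x₀, (assemble x₀ (w i, b i)).2) *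
            inner ℝ (assemble x₀ (w i, b i)).1 (u j) < _ at hj
        rw [h4] at hj
        have h6 := (abs_le.1 h3).1
        nlinarith
    _ ≤ D A + ENNReal.ofReal (δ / 2) := by
        refine (measure_union_le _ _).trans (add_le_add (le_of_eq ?_) hDZ)
        rw [Measure.prod_prod, measure_univ, mul_one]
    _ ≤ ENNReal.ofReal δ := by
        refine (add_le_add_left hDA _).trans ?_
        rw [← ENNReal.ofReal_add (by positivity) (by positivity), add_halves]

end Multiplier

/-! ### A truncated quadratic and its Gaussian mean -/

section Tent

/-- A `1`-Lipschitz bump supported in `1 ≤ |x| ≤ 3` and dominated by `x ^ 2`. -/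
noncomputable def tent (x : ℝ) : ℝ := max 0 (min (|x| - 1) (3 - |x|))

theorem tent_nonneg (x : ℝ) : 0 ≤ tent x := le_max_left _ _

theorem tent_zero : tent 0 = 0 := by simp [tent]

theorem tent_eq_zero {x : ℝ} (hx : 3 ≤ |x|) : tent x = 0 :=
  max_eq_left ((min_le_right _ _).trans (by linarith))

theorem tent_le_one (x : ℝ) : tent x ≤ 1 := by
  refine max_le zero_le_one ?_
  rcases le_total |x| 2 with h | h
  · exact (min_le_left _ _).trans (by linarith)
  · exact (min_le_right _ _).trans (by linarith)

theorem tent_le_sq (x : ℝ) : tent x ≤ x ^ 2 := by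
  refine max_le (sq_nonneg _) ((min_le_left _ _).trans ?_)
  nlinarith [sq_abs x, sq_nonneg (|x| - 1)]

theorem continuous_tent : Continuous tent := by unfold tent; fun_prop

theorem abs_tent_sub_le (x y : ℝ) : |tent x - tent y| ≤ |x - y| := by
  refine (abs_max_sub_max_le_max _ _ _ _).trans ?_
  refine max_le (by simp) ((abs_min_sub_min_le_max _ _ _ _).trans ?_)
  have h := abs_abs_sub_abs_le_abs_sub x y
  refine max_le ?_ ?_
  · rwa [sub_sub_sub_cancel_right]
  · rw [sub_sub_sub_cancel_left, abs_sub_comm]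
    exact h

/-- The mean of the bump under the standard Gaussian measure. -/
noncomputable def tentMean : ℝ := ∫ x, tent x ∂(gaussianReal 0 1)

theorem integrable_tent : Integrable tent (gaussianReal 0 1) :=
  Integrable.of_bound continuous_tent.aestronglyMeasurable 1 (.of_forall fun x => by
    rw [Real.norm_eq_abs, abs_of_nonneg (tent_nonneg x)]; exact tent_le_one x)

theorem gaussianReal_pos_of_isOpen {s : Set ℝ} (hs : IsOpen s) (hne : s.Nonempty) :
    0 < gaussianReal 0 1 s := by
  rw [pos_iff_ne_zero]
  intro h
  exact (hs.measure_pos volume hne).ne'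
    (gaussianReal_absolutelyContinuous' 0 one_ne_zero h)

theorem tentMean_pos : 0 < tentMean := by
  rw [tentMean, integral_pos_iff_support_of_nonneg tent_nonneg integrable_tent]
  refine (gaussianReal_pos_of_isOpen (s := Set.Ioo 1 3) isOpen_Ioo ⟨2, by norm_num⟩).trans_le
    (measure_mono ?_)
  rintro x ⟨h1, h2⟩
  have hx : |x| = x := abs_of_pos (by linarith)
  have : 0 < min (|x| - 1) (3 - |x|) := by rw [hx]; exact lt_min (by linarith) (by linarith)
  exact (this.trans_le (le_max_right _ _)).ne'

/-- The mean of the positive part of a standard Gaussian variable. -/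
noncomputable def posPartMean : ℝ := ∫ x, max 0 x ∂(gaussianReal 0 1)

theorem integrable_posPart : Integrable (fun x : ℝ => max 0 x) (gaussianReal 0 1) := by
  refine Integrable.mono' (IsGaussian.integrable_id (μ := gaussianReal 0 1)).abs
    (by fun_prop) (.of_forall fun x => ?_)
  rw [Real.norm_eq_abs, abs_of_nonneg (le_max_left _ _)]
  exact max_le (abs_nonneg _) (le_abs_self _)

theorem posPartMean_pos : 0 < posPartMean := by
  rw [posPartMean, integral_pos_iff_support_of_nonneg (f := fun x : ℝ => max 0 x)
    (fun x => le_max_left _ _) integrable_posPart]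
  refine (gaussianReal_pos_of_isOpen (s := Set.Ioi 0) isOpen_Ioi ⟨1, by simp⟩).trans_le
    (measure_mono ?_)
  intro x hx
  exact (lt_max_of_lt_right hx).ne'

theorem integrable_sq_gaussianReal : Integrable (fun x : ℝ => x ^ 2) (gaussianReal 0 1) :=
  (IsGaussian.memLp_two_id (μ := gaussianReal 0 1)).integrable_sq

/-- A truncation level for standard Gaussian variables that keeps half of the mean of the bump. -/
noncomputable def truncLevel : ℝ :=
  Real.sqrt (8 * (1 + ∫ x, x ^ 2 ∂(gaussianReal 0 1)) / tentMean)

theorem sq_moment_nonneg : 0 ≤ ∫ x : ℝ, x ^ 2 ∂(gaussianReal 0 1) :=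
  integral_nonneg fun x => sq_nonneg x

theorem truncLevel_pos : 0 < truncLevel :=
  Real.sqrt_pos.2 (div_pos (by linarith [sq_moment_nonneg]) tentMean_pos)

variable {E : Type*} [NormedAddCommGroup E] [InnerProductSpace ℝ E]

/-- The bump at `⟨x, u⟩`, switched off where `⟨x, x₀⟩` is large. -/
noncomputable def truncTent (x₀ x u : E) : ℝ :=
  if |inner ℝ x x₀| ≤ truncLevel / 2 then tent (inner ℝ x u) else 0

theorem truncTent_zero (x₀ x : E) : truncTent x₀ x 0 = 0 := by simp [truncTent, tent_zero]

theorem truncTent_nonneg (x₀ x u : E) : 0 ≤ truncTent x₀ x u := by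
  unfold truncTent; split_ifs
  exacts [tent_nonneg _, le_rfl]

theorem truncTent_le_one (x₀ x u : E) : truncTent x₀ x u ≤ 1 := by
  unfold truncTent; split_ifs
  exacts [tent_le_one _, zero_le_one]

theorem abs_truncTent_sub_le (x₀ x u v : E) :
    |truncTent x₀ x u - truncTent x₀ x v| ≤ |inner ℝ x u - inner ℝ x v| := by
  unfold truncTent; split_ifs
  · exact abs_tent_sub_le _ _
  · simp

theorem continuous_truncTent (x₀ x : E) : Continuous (truncTent x₀ x) := by
  unfold truncTent; split_ifs
  · exact continuous_tent.comp (by fun_prop)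
  · fun_prop

/-- Where the cutoff is active, 4⟨x, x₀⟩²/`truncLevel`² is at least 1 and so exceeds the bump. -/
theorem tent_sub_le_truncTent (x₀ x u : E) :
    tent (inner ℝ x u) - 4 / truncLevel ^ 2 * inner ℝ x x₀ ^ 2 ≤ truncTent x₀ x u := by
  have hc := truncLevel_pos
  unfold truncTent; split_ifs with h
  · linarith [show 0 ≤ 4 / truncLevel ^ 2 * inner ℝ x x₀ ^ 2 by positivity]
  · push Not at h
    have h1 : (truncLevel / 2) ^ 2 ≤ inner ℝ x x₀ ^ 2 := by
      rw [← sq_abs (inner ℝ x x₀)]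
      exact pow_le_pow_left₀ (by positivity) h.le 2
    have h2 : 1 ≤ 4 / truncLevel ^ 2 * inner ℝ x x₀ ^ 2 := by
      rw [div_mul_eq_mul_div, le_div_iff₀ (by positivity)]
      linarith
    linarith [tent_le_one (inner ℝ x u)]

variable [FiniteDimensional ℝ E] [MeasurableSpace E] [BorelSpace E]

theorem integral_inner_stdGaussian {u : E} (hu : ‖u‖ = 1) {φ : ℝ → ℝ} (hφ : Continuous φ) :
    ∫ x, φ (inner ℝ x u) ∂(stdGaussian E) = ∫ t, φ t ∂(gaussianReal 0 1) := by
  rw [← stdGaussian_map_inner_of_norm_eq_one hu, integral_map (by fun_prop)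
    hφ.aestronglyMeasurable]

theorem integrable_comp_inner_stdGaussian {u : E} (hu : ‖u‖ = 1) {φ : ℝ → ℝ}
    (hφ : Integrable φ (gaussianReal 0 1)) :
    Integrable (fun x => φ (inner ℝ x u)) (stdGaussian E) := by
  rw [← stdGaussian_map_inner_of_norm_eq_one hu] at hφ
  exact hφ.comp_measurable (by fun_prop)

theorem integrable_truncTent (x₀ u : E) :
    Integrable (fun x => truncTent x₀ x u) (stdGaussian E) := by
  refine Integrable.of_bound ?_ 1 (.of_forall fun x => ?_)
  · have : Measurable fun x => truncTent x₀ x u := by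
      unfold truncTent
      refine Measurable.ite (measurableSet_le (by fun_prop) measurable_const) ?_ measurable_const
      exact continuous_tent.measurable.comp (by fun_prop)
    exact this.aestronglyMeasurable
  · rw [Real.norm_eq_abs, abs_of_nonneg (truncTent_nonneg _ _ _)]
    exact truncTent_le_one _ _ _

/-- The cutoff costs at most 4V/`truncLevel`², with V the second moment of a standard Gaussian; the
truncation level is chosen so that this is at most half of `tentMean`. Independence of ⟨x, u⟩ and
⟨x, x₀⟩ is not needed. -/
theorem half_tentMean_le_integral_truncTent {x₀ u : E} (hx : ‖x₀‖ = 1) (hu : ‖u‖ = 1) :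
    tentMean / 2 ≤ ∫ x, truncTent x₀ x u ∂(stdGaussian E) := by
  have i1 := integrable_comp_inner_stdGaussian hu integrable_tent
  have i2 := (integrable_comp_inner_stdGaussian hx integrable_sq_gaussianReal).const_mul
    (4 / truncLevel ^ 2)
  have h := integral_mono (i1.sub i2) (integrable_truncTent x₀ u) fun x =>
    tent_sub_le_truncTent x₀ x u
  simp only [Pi.sub_apply] at h
  rw [integral_sub i1 i2, integral_const_mul, integral_inner_stdGaussian hu continuous_tent,
    integral_inner_stdGaussian hx (φ := fun t => t ^ 2) (by fun_prop)] at h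
  have hp := tentMean_pos
  have hV := sq_moment_nonneg
  set V := ∫ x : ℝ, x ^ 2 ∂(gaussianReal 0 1) with hVdef
  have hl : truncLevel ^ 2 = 8 * (1 + V) / tentMean :=
    Real.sq_sqrt (div_nonneg (by linarith) hp.le)
  have h2 : 4 / truncLevel ^ 2 * V ≤ tentMean / 2 := by
    rw [hl]
    have : 4 / (8 * (1 + V) / tentMean) * V = tentMean / 2 * (V / (1 + V)) := by
      field_simp; ring
    rw [this]
    exact mul_le_of_le_one_right (by positivity) ((div_le_one (by linarith)).2 (by linarith))
  have h3 : ∫ x, tent x ∂(gaussianReal 0 1) = tentMean := rfl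
  linarith

end Tent

/-! ### Mean width of bounded sets -/

section MeanWidth

variable {n : ℕ} {S : Set (EuclideanSpace ℝ (Fin n))}

theorem bddAbove_inner_image (hS : Bornology.IsBounded S) (g : EuclideanSpace ℝ (Fin n)) :
    BddAbove ((fun x => inner ℝ g x) '' S) := by
  obtain ⟨r, hr⟩ := hS.exists_norm_le
  refine ⟨‖g‖ * r, ?_⟩
  rintro _ ⟨x, hx, rfl⟩
  exact (real_inner_le_norm _ _).trans (mul_le_mul_of_nonneg_left (hr x hx) (norm_nonneg _))

theorem integrable_sSup_inner (hS : Bornology.IsBounded S) (hne : S.Nonempty) :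
    Integrable (fun g => sSup ((fun x => inner ℝ g x) '' S))
      (stdGaussian (EuclideanSpace ℝ (Fin n))) := by
  obtain ⟨r, hr0, hr⟩ := hS.exists_pos_norm_le
  -- A bounded set has a Lipschitz support function, which gives both measurability and linear
  -- growth.
  have hL : LipschitzWith r.toNNReal
      (fun g : EuclideanSpace ℝ (Fin n) => sSup ((fun x => inner ℝ g x) '' S)) := by
    refine LipschitzWith.of_le_add_mul _ fun g g' => ?_
    rw [Real.coe_toNNReal _ hr0.le]
    refine csSup_le (hne.image _) ?_
    rintro _ ⟨x, hx, rfl⟩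
    have h1 : inner ℝ g' x ≤ sSup ((fun x => inner ℝ g' x) '' S) :=
      le_csSup (bddAbove_inner_image hS g') ⟨x, hx, rfl⟩
    have h2 : inner ℝ g x = inner ℝ g' x + inner ℝ (g - g') x := by
      rw [inner_sub_left]; ring
    have h3 : inner ℝ (g - g') x ≤ r * dist g g' := by
      rw [dist_eq_norm, mul_comm]
      exact (real_inner_le_norm _ _).trans
        (mul_le_mul_of_nonneg_left (hr x hx) (norm_nonneg _))
    dsimp only
    linarith
  have h0 : sSup ((fun x => inner ℝ (0 : EuclideanSpace ℝ (Fin n)) x) '' S) = 0 := by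
    simp [hne.image_const]
  refine Integrable.mono' ((IsGaussian.integrable_id
    (μ := stdGaussian (EuclideanSpace ℝ (Fin n)))).norm.const_mul r)
    hL.continuous.aestronglyMeasurable (.of_forall fun g => ?_)
  have := hL.dist_le_mul g 0
  rw [Real.dist_eq, h0, sub_zero, dist_zero_right, Real.coe_toNNReal _ hr0.le] at this
  exact this

theorem integral_iSup_inner_le_meanWidth (hS : Bornology.IsBounded S) {ι : Type*} [Finite ι]
    [Nonempty ι] {u : ι → EuclideanSpace ℝ (Fin n)} {r : ℝ} (hr : 0 < r)
    (hu : ∀ j, r • u j ∈ S) :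
    ∫ x, ⨆ j, inner ℝ x (u j) ∂(stdGaussian (EuclideanSpace ℝ (Fin n))) ≤ meanWidth S / r := by
  have j : ι := Classical.arbitrary ι
  rw [le_div_iff₀ hr, mul_comm, ← integral_const_mul]
  refine integral_mono ((integrable_iSup fun j => integrable_inner_stdGaussian (u j)).const_mul r)
    (integrable_sSup_inner hS ⟨_, hu j⟩) fun g => ?_
  dsimp only
  rw [Real.mul_iSup_of_nonneg hr.le]
  refine ciSup_le fun j => le_csSup (bddAbove_inner_image hS g) ⟨r • u j, hu j, ?_⟩
  simp only [real_inner_smul_right]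

/-- The set contains the two points 0 and r u, whose mean width is r E[max(0, g)]. This lower bound
absorbs additive constants into w/r and shows that a set of zero width is a single point. -/
theorem mul_posPartMean_le_meanWidth (hS : Bornology.IsBounded S) (h0 : 0 ∈ S)
    {u : EuclideanSpace ℝ (Fin n)} (hu : ‖u‖ = 1) {r : ℝ} (hr : 0 ≤ r) (hru : r • u ∈ S) :
    r * posPartMean ≤ meanWidth S := by
  rw [posPartMean, ← integral_inner_stdGaussian hu (φ := fun t => max 0 t) (by fun_prop),
    ← integral_const_mul]
  refine integral_mono ((integrable_comp_inner_stdGaussian hu integrable_posPart).const_mul r)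
    (integrable_sSup_inner hS ⟨0, h0⟩) fun g => ?_
  dsimp only
  rw [mul_max_of_nonneg _ _ hr, mul_zero]
  exact max_le (le_csSup (bddAbove_inner_image hS g) ⟨0, h0, by simp⟩)
    (le_csSup (bddAbove_inner_image hS g) ⟨r • u, hru, by simp [real_inner_smul_right]⟩)

end MeanWidth

/-! ### Regular directions with high probability -/

section Core

variable {n m : ℕ} {Ω Ξ : Type*} [MeasurableSpace Ω] [MeasurableSpace Ξ]
  {P : Measure Ω} [IsProbabilityMeasure P] {ν : Measure Ξ}
  {Y : Set ℝ} {f : Ξ → ℝ → ℝ} {L : ℝ → ℝ → ℝ}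
  {a : Fin m → Ω → EuclideanSpace ℝ (Fin n)} {s : Fin m → Ω → Ξ}

theorem IsObservationModel.measurePreserving_pair (h : IsObservationModel P ν Y f a s) (i : Fin m) :
    MeasurePreserving (fun ω => (a i ω, s i ω)) P
      ((stdGaussian (EuclideanSpace ℝ (Fin n))).prod ν) := by
  refine ⟨(h.measurable_a i).prodMk (h.measurable_s i), ?_⟩
  rw [(indepFun_iff_map_prod_eq_prod_map_map (h.measurable_a i).aemeasurable
    (h.measurable_s i).aemeasurable).1 (h.indep_pair i), h.law_a, h.law_s]

theorem IsObservationModel.measurePreserving_pairs (h : IsObservationModel P ν Y f a s) :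
    MeasurePreserving (fun ω i => (a i ω, s i ω)) P
      (Measure.pi fun _ => (stdGaussian (EuclideanSpace ℝ (Fin n))).prod ν) := by
  refine ⟨measurable_pi_lambda _ fun i => (h.measurePreserving_pair i).measurable, ?_⟩
  rw [iIndepFun.map_fun_eq_pi_map (fun i => (h.measurePreserving_pair i).measurable.aemeasurable)
    h.indep]
  simp_rw [(h.measurePreserving_pair _).map_eq]

variable [IsProbabilityMeasure ν]

theorem IsObservationModel.measurePreserving_vectors (h : IsObservationModel P ν Y f a s) :
    MeasurePreserving (fun ω i => a i ω) P
      (Measure.pi fun _ => stdGaussian (EuclideanSpace ℝ (Fin n))) :=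
  (measurePreserving_pi (fun _ => (stdGaussian (EuclideanSpace ℝ (Fin n))).prod ν)
    (fun _ => stdGaussian (EuclideanSpace ℝ (Fin n)))
    fun _ => measurePreserving_fst).comp h.measurePreserving_pairs

theorem IsObservationModel.measurePreserving_scalar (h : IsObservationModel P ν Y f a s)
    {x₀ : EuclideanSpace ℝ (Fin n)} (hx : ‖x₀‖ = 1) (i : Fin m) :
    MeasurePreserving (fun ω => (inner ℝ (a i ω) x₀, s i ω)) P (scalarLaw ν) := by
  have h1 : MeasurePreserving (fun x => inner ℝ x x₀)
      (stdGaussian (EuclideanSpace ℝ (Fin n))) (gaussianReal 0 1) :=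
    ⟨by fun_prop, stdGaussian_map_inner_of_norm_eq_one hx⟩
  exact (h1.prod (MeasurePreserving.id ν)).comp (h.measurePreserving_pair i)

/-- The deterministic conditions on the measurements that yield the error bound, in direction
`u`: a lower bound for the truncated empirical bump, an upper bound for the empirical second
moment, and a lower bound for the multiplier term with multipliers `z`. -/
structure RegularDirection {n m : ℕ} (x₀ : EuclideanSpace ℝ (Fin n)) (B A : ℝ)
    (a : Fin m → EuclideanSpace ℝ (Fin n)) (z : Fin m → ℝ) (u : EuclideanSpace ℝ (Fin n)) :
    Prop where
  bump : tentMean / 4 * m ≤ ∑ i, truncTent x₀ (a i) u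
  second : ∑ i, inner ℝ (a i) u ^ 2 ≤ B * m
  multiplier : -A ≤ ∑ i, z i * inner ℝ (a i) u

theorem isClosed_regularDirection (x₀ : EuclideanSpace ℝ (Fin n)) (B A : ℝ)
    (a : Fin m → EuclideanSpace ℝ (Fin n)) (z : Fin m → ℝ) :
    IsClosed {u | RegularDirection x₀ B A a z u} := by
  have h : {u | RegularDirection x₀ B A a z u} =
      {u | tentMean / 4 * m ≤ ∑ i, truncTent x₀ (a i) u} ∩
      ({u | ∑ i, inner ℝ (a i) u ^ 2 ≤ B * m} ∩ {u | -A ≤ ∑ i, z i * inner ℝ (a i) u}) := by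
    ext u
    exact ⟨fun h => ⟨h.1, h.2, h.3⟩, fun h => ⟨h.1, h.2.1, h.2.2⟩⟩
  rw [h]
  refine (isClosed_le continuous_const ?_).inter
    ((isClosed_le ?_ continuous_const).inter (isClosed_le continuous_const ?_))
  · exact continuous_finsetSum _ fun i _ => continuous_truncTent x₀ (a i)
  · fun_prop
  · fun_prop

/-- Each of the three conditions fails with probability at most δ/3. The zero vector is in the
family only to make suprema nonnegative; the lower bound on the mean of the bump holds for unit
vectors, hence the restriction to them. -/
theorem measure_exists_not_regularDirection_le {ι : Type*} [Finite ι] [Nonempty ι]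
    (h : IsObservationModel P ν Y f a s) (hm : 0 < m) {x₀ : EuclideanSpace ℝ (Fin n)}
    (hx : ‖x₀‖ = 1) {μ σ η : ℝ} (hpar : IsModelParam ν L f μ σ η)
    {u : ι → EuclideanSpace ℝ (Fin n)} (hu : ∀ j, ‖u j‖ ≤ 1) {j₀ : ι} (h₀ : u j₀ = 0)
    {W δ : ℝ} (hδ : 0 < δ) (hW0 : 0 < W)
    (hW : ∫ x, ⨆ j, inner ℝ x (u j) ∂(stdGaussian (EuclideanSpace ℝ (Fin n))) ≤ W)
    (hWm : W ^ 2 ≤ m) (hWδ : 2 * W ≤ tentMean / 4 * (δ / 3) * Real.sqrt m) :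
    P {ω | ∃ j, ‖u j‖ = 1 ∧ ¬ RegularDirection x₀ (16 * (1 + gaussianSqMoment + 1 / (δ / 3)))
        ((1 + 2 / (δ / 3)) * (Real.sqrt m * max 1 (max σ η)) * (W + 1)) (fun i => a i ω)
        (fun i => residual L f μ (inner ℝ (a i ω) x₀, s i ω)) (u j)} ≤ ENNReal.ofReal δ := by
  have := Fintype.ofFinite ι
  set γ := stdGaussian (EuclideanSpace ℝ (Fin n))
  set M := max 1 (max σ η) with hM
  have hM0 : 0 < M := lt_of_lt_of_le one_pos (le_max_left _ _)
  have hδ3 : 0 < δ / 3 := by positivity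
  -- The residual is only almost everywhere measurable, so it is replaced by a measurable version;
  -- the two agree at all m observations almost surely.
  set z := hpar.memLp_sigma.1.mk (residual L f μ) with hz
  have hzm : Measurable z := hpar.memLp_sigma.1.stronglyMeasurable_mk.measurable
  have hzae : residual L f μ =ᵐ[scalarLaw ν] z := hpar.memLp_sigma.1.ae_eq_mk
  have hzg : (fun p => residual L f μ p * p.1) =ᵐ[scalarLaw ν] fun p => z p * p.1 := by
    filter_upwards [hzae] with p hp
    rw [hp]
  have hz2 : (fun p => residual L f μ p ^ 2) =ᵐ[scalarLaw ν] fun p => z p ^ 2 := by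
    filter_upwards [hzae] with p hp
    rw [hp]
  have hzg2 : (fun p => residual L f μ p ^ 2 * p.1 ^ 2) =ᵐ[scalarLaw ν]
      fun p => z p ^ 2 * p.1 ^ 2 := by
    filter_upwards [hzae] with p hp
    rw [hp]
  set E1 : Set (Fin m → EuclideanSpace ℝ (Fin n)) :=
    {a | ∃ j, tentMean / 4 * m ≤ ∑ i, (∫ y, truncTent x₀ y (u j) ∂γ - truncTent x₀ (a i) (u j))}
  set E2 : Set (Fin m → EuclideanSpace ℝ (Fin n)) :=
    {a | ∃ j, 16 * (1 + gaussianSqMoment + 1 / (δ / 3)) * m ≤ ∑ i, inner ℝ (a i) (u j) ^ 2}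
  set E3 : Set (Fin m → EuclideanSpace ℝ (Fin n) × Ξ) :=
    {q | ∃ j, ∑ i, z (inner ℝ (q i).1 x₀, (q i).2) * inner ℝ (q i).1 (u j) <
        -((1 + 2 / (δ / 3)) * (Real.sqrt m * M) * (W + 1))}
  have hE1 : P ((fun ω i => a i ω) ⁻¹' E1) ≤ ENNReal.ofReal (δ / 3) := by
    refine (h.measurePreserving_vectors.measure_preimage_le E1).trans ?_
    exact measure_exists_sum_centred_ge_le u (ψ := fun x j => truncTent x₀ x (u j))
      (fun j => integrable_truncTent x₀ (u j))
      (fun x j k => abs_truncTent_sub_le x₀ x (u j) (u k)) (j₀ := j₀)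
      (fun x => by simp only [h₀, truncTent_zero]) hm hW (by linarith [tentMean_pos]) hWδ
  have hE2 : P ((fun ω i => a i ω) ⁻¹' E2) ≤ ENNReal.ofReal (δ / 3) :=
    (h.measurePreserving_vectors.measure_preimage_le E2).trans
      (measure_exists_sum_inner_sq_ge_le hu hm hδ3 hW hWm)
  have hE3 : P ((fun ω i => (a i ω, s i ω)) ⁻¹' E3) ≤ ENNReal.ofReal (δ / 3) := by
    refine (h.measurePreserving_pairs.measure_preimage_le E3).trans ?_
    refine measure_exists_multiplier_le hu h₀ hx hzm (hpar.memLp_sigma.ae_eq hzae)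
      (hpar.memLp_eta.ae_eq hzg) ?_ hM0 ?_ ?_ hW0 hδ3 hW hm
    · rw [← integral_congr_ae hzg]; exact hpar.mu_eq
    · rw [← integral_congr_ae hz2, ← hpar.sigma_sq]
      exact pow_le_pow_left₀ hpar.sigma_nonneg
        ((le_max_left _ _).trans (le_max_right _ _)) 2
    · rw [← integral_congr_ae hzg2, ← hpar.eta_sq]
      exact pow_le_pow_left₀ hpar.eta_nonneg
        ((le_max_right _ _).trans (le_max_right _ _)) 2
  have hE4 : P {ω | ¬ ∀ i, residual L f μ (inner ℝ (a i ω) x₀, s i ω)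
      = z (inner ℝ (a i ω) x₀, s i ω)} = 0 := by
    have : ∀ᵐ ω ∂P, ∀ i, residual L f μ (inner ℝ (a i ω) x₀, s i ω)
        = z (inner ℝ (a i ω) x₀, s i ω) :=
      ae_all_iff.2 fun i => (h.measurePreserving_scalar hx i).quasiMeasurePreserving.ae hzae
    exact this
  calc _ ≤ P (((fun ω i => a i ω) ⁻¹' E1 ∪ (fun ω i => a i ω) ⁻¹' E2) ∪
        ((fun ω i => (a i ω, s i ω)) ⁻¹' E3 ∪ {ω | ¬ ∀ i, residual L f μ
          (inner ℝ (a i ω) x₀, s i ω) = z (inner ℝ (a i ω) x₀, s i ω)})) := by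
        refine measure_mono ?_
        rintro ω ⟨j, hj1, hj⟩
        by_contra hc
        simp only [Set.mem_union, not_or] at hc
        obtain ⟨⟨c1, c2⟩, c3, c4⟩ := hc
        have c4' : ∀ i, residual L f μ (inner ℝ (a i ω) x₀, s i ω)
            = z (inner ℝ (a i ω) x₀, s i ω) := not_not.1 c4
        refine hj ⟨?_, ?_, ?_⟩
        · by_contra hb
          refine c1 ⟨j, ?_⟩
          rw [Finset.sum_sub_distrib]
          have h1 := half_tentMean_le_integral_truncTent hx hj1
          simp only [Finset.sum_const, Finset.card_univ, Fintype.card_fin, nsmul_eq_mul]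
          have h2 := mul_le_mul_of_nonneg_left h1 (Nat.cast_nonneg (α := ℝ) m)
          linarith
        · by_contra hb
          exact c2 ⟨j, (not_le.1 hb).le⟩
        · by_contra hb
          refine c3 ⟨j, ?_⟩
          simp only [c4'] at hb
          exact not_le.1 hb
    _ ≤ (ENNReal.ofReal (δ / 3) + ENNReal.ofReal (δ / 3)) + (ENNReal.ofReal (δ / 3) + 0) := by
        refine (measure_union_le _ _).trans (add_le_add ((measure_union_le _ _).trans
          (add_le_add hE1 hE2)) ((measure_union_le _ _).trans (add_le_add hE3 hE4.le)))
    _ = _ := by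
        rw [add_zero, ← ENNReal.ofReal_add hδ3.le hδ3.le, ← ENNReal.ofReal_add (by positivity) hδ3.le]
        congr 1; ring

/-- With high probability all unit vectors in a set of small mean width are regular directions. -/
theorem measure_exists_mem_not_regularDirection_le
    (h : IsObservationModel P ν Y f a s) (hm : 0 < m) {x₀ : EuclideanSpace ℝ (Fin n)}
    (hx : ‖x₀‖ = 1) {μ σ η : ℝ} (hpar : IsModelParam ν L f μ σ η)
    {U S : Set (EuclideanSpace ℝ (Fin n))} (hS : Bornology.IsBounded S) (hS0 : 0 ∈ S)
    {r : ℝ} (hr : 0 < r) (hU1 : ∀ u ∈ U, ‖u‖ = 1) (hUS : ∀ u ∈ U, r • u ∈ S)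
    {δ : ℝ} (hδ : 0 < δ) (hW0 : 0 < meanWidth S)
    (hWm : (meanWidth S / r) ^ 2 ≤ m)
    (hWδ : 2 * (meanWidth S / r) ≤ tentMean / 4 * (δ / 3) * Real.sqrt m) :
    P {ω | ∃ u ∈ U, ¬ RegularDirection x₀ (16 * (1 + gaussianSqMoment + 1 / (δ / 3)))
        ((1 + 2 / (δ / 3)) * (Real.sqrt m * max 1 (max σ η)) * (meanWidth S / r + 1))
        (fun i => a i ω)
        (fun i => residual L f μ (inner ℝ (a i ω) x₀, s i ω)) u} ≤ ENNReal.ofReal δ := by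
  rcases U.eq_empty_or_nonempty with hU | hU
  · simp [hU]
  have := hU.to_subtype
  -- Regularity is a closed condition on the direction, so it suffices to check it on a countable
  -- dense subset.
  set d : ℕ → EuclideanSpace ℝ (Fin n) := fun k => (TopologicalSpace.denseSeq U k : U) with hd
  have hdU : ∀ k, d k ∈ U := fun k => (TopologicalSpace.denseSeq U k).2
  set G : Ω → EuclideanSpace ℝ (Fin n) → Prop := fun ω u =>
    RegularDirection x₀ (16 * (1 + gaussianSqMoment + 1 / (δ / 3)))
        ((1 + 2 / (δ / 3)) * (Real.sqrt m * max 1 (max σ η)) * (meanWidth S / r + 1))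
        (fun i => a i ω)
        (fun i => residual L f μ (inner ℝ (a i ω) x₀, s i ω)) u with hG
  have hsub : {ω | ∃ u ∈ U, ¬ G ω u} ⊆ ⋃ k : ℕ, {ω | ∃ j < k, ¬ G ω (d j)} := by
    rintro ω ⟨u, hu, hGu⟩
    by_contra hc
    simp only [Set.mem_iUnion, not_exists] at hc
    refine hGu ?_
    have hall : ∀ j, G ω (d j) := by
      intro j
      by_contra hj
      exact hc (j + 1) ⟨j, j.lt_succ_self, hj⟩
    have hcl : IsClosed {v : U | G ω v} :=
      (isClosed_regularDirection x₀ _ _ _ _).preimage continuous_subtype_val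
    exact (TopologicalSpace.denseRange_denseSeq U).induction_on (p := fun v : U => G ω v)
      ⟨u, hu⟩ hcl hall
  have hmono : Monotone fun k : ℕ => {ω | ∃ j < k, ¬ G ω (d j)} := by
    rintro k l hkl ω ⟨j, hj, hGj⟩
    exact ⟨j, hj.trans_le hkl, hGj⟩
  refine (measure_mono hsub).trans ?_
  -- Continuity from below reduces the countable family to its finite initial parts, with a bound
  -- that does not depend on their size.
  rw [hmono.measure_iUnion]
  refine iSup_le fun k => ?_
  set u : Option (Fin k) → EuclideanSpace ℝ (Fin n) := fun o => o.elim 0 fun j => d j with hu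
  have hfin := measure_exists_not_regularDirection_le h hm hx hpar (u := u)
    (by rintro (_ | j)
        · simp [hu]
        · exact (hU1 _ (hdU j)).le) (j₀ := none) rfl hδ (div_pos hW0 hr)
    (integral_iSup_inner_le_meanWidth hS hr (by
      rintro (_ | j)
      · simpa [hu] using hS0
      · exact hUS _ (hdU j))) hWm hWδ
  refine (measure_mono ?_).trans hfin
  rintro ω ⟨j, hj, hGj⟩
  exact ⟨some ⟨j, hj⟩, hU1 _ (hdU j), hGj⟩

end Core

/-! ### Second order Taylor bound for the loss -/

section Curvature

theorem add_half_le_of_deriv_ge {q q₁ q₂ : ℝ → ℝ} {k : ℝ}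
    (h₁ : ∀ θ, HasDerivAt q (q₁ θ) θ) (h₂ : ∀ θ, HasDerivAt q₁ (q₂ θ) θ)
    (hk : ∀ θ ∈ Set.Icc (0 : ℝ) 1, k ≤ q₂ θ) : q 0 + q₁ 0 + k / 2 ≤ q 1 := by
  -- Monotonicity is used twice, first for the derivative minus its linear lower bound, then for the
  -- function minus its quadratic lower bound.
  have hd1 : ∀ θ : ℝ, HasDerivAt (fun θ => q₁ θ - k * θ) (q₂ θ - k) θ := fun θ => by
    simpa using (h₂ θ).fun_sub ((hasDerivAt_id θ).const_mul k)
  have m1 : MonotoneOn (fun θ => q₁ θ - k * θ) (Set.Icc 0 1) :=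
    monotoneOn_of_hasDerivWithinAt_nonneg (convex_Icc 0 1)
      (fun θ _ => (hd1 θ).continuousAt.continuousWithinAt)
      (fun θ _ => (hd1 θ).hasDerivWithinAt)
      (fun θ hθ => sub_nonneg.2 (hk θ (interior_subset hθ)))
  have hd2 : ∀ θ : ℝ, HasDerivAt (fun θ => q θ - q₁ 0 * θ - k * (θ ^ 2 / 2))
      (q₁ θ - q₁ 0 - k * θ) θ := fun θ => by
    have h3 : HasDerivAt (fun θ : ℝ => θ ^ 2 / 2) θ θ := by
      refine ((hasDerivAt_pow 2 θ).div_const 2).congr_deriv ?_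
      norm_num
    simpa using ((h₁ θ).fun_sub ((hasDerivAt_id θ).const_mul (q₁ 0))).fun_sub (h3.const_mul k)
  have m2 : MonotoneOn (fun θ => q θ - q₁ 0 * θ - k * (θ ^ 2 / 2)) (Set.Icc 0 1) :=
    monotoneOn_of_hasDerivWithinAt_nonneg (convex_Icc 0 1)
      (fun θ _ => (hd2 θ).continuousAt.continuousWithinAt)
      (fun θ _ => (hd2 θ).hasDerivWithinAt)
      (fun θ hθ => by
        have hθ' := interior_subset hθ
        have := m1 (Set.left_mem_Icc.2 zero_le_one) hθ' hθ'.1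
        simp only at this
        linarith)
  have := m2 (Set.left_mem_Icc.2 zero_le_one) (Set.right_mem_Icc.2 zero_le_one) zero_le_one
  simp only at this
  linarith

variable {Y : Set ℝ} {L : ℝ → ℝ → ℝ} {Λ : ℝ} {F : ℝ → ℝ}

theorem IsCurvedLoss.hasDerivAt (hL : IsCurvedLoss Y L Λ F) {y : ℝ} (hy : y ∈ Y) (v : ℝ) :
    HasDerivAt (fun u => L u y) (lossDeriv L v y) v :=
  ((hL.contDiff y hy).differentiable two_ne_zero v).hasDerivAt

theorem IsCurvedLoss.hasDerivAt_lossDeriv (hL : IsCurvedLoss Y L Λ F) {y : ℝ} (hy : y ∈ Y)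
    (v : ℝ) : HasDerivAt (fun u => lossDeriv L u y) (lossDeriv₂ L v y) v := by
  have h1 : ContDiff ℝ 1 (deriv fun u => L u y) := (hL.contDiff y hy).deriv'
  have h2 := (h1.differentiable one_ne_zero v).hasDerivAt
  rw [lossDeriv₂, iteratedDeriv_succ, iteratedDeriv_one]
  exact h2

/-- Quadratic lower bound for the loss on an interval where its curvature is bounded below. -/
theorem IsCurvedLoss.quadratic_lower_bound (hL : IsCurvedLoss Y L Λ F) {y : ℝ} (hy : y ∈ Y)
    {v x k : ℝ} (hk : ∀ θ ∈ Set.Icc (0 : ℝ) 1, k ≤ F (v + θ * x)) :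
    lossDeriv L v y * x + k / 2 * x ^ 2 ≤ L (v + x) y - L v y := by
  have hlin : ∀ θ : ℝ, HasDerivAt (fun θ : ℝ => v + θ * x) x θ := fun θ => by
    simpa using ((hasDerivAt_id θ).mul_const x).const_add v
  have h := add_half_le_of_deriv_ge (q := fun θ => L (v + θ * x) y)
    (q₁ := fun θ => lossDeriv L (v + θ * x) y * x)
    (q₂ := fun θ => lossDeriv₂ L (v + θ * x) y * x * x) (k := k * x ^ 2)
    (fun θ => HasDerivAt.comp (h₂ := fun u => L u y) θ (hL.hasDerivAt hy (v + θ * x)) (hlin θ))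
    (fun θ => (HasDerivAt.comp (h₂ := fun u => lossDeriv L u y) θ
      (hL.hasDerivAt_lossDeriv hy (v + θ * x)) (hlin θ)).mul_const x)
    (fun θ hθ => by
      have := mul_le_mul_of_nonneg_right ((hk θ hθ).trans (hL.curvature_le (v + θ * x) y hy))
        (sq_nonneg x)
      linarith)
  simp only [zero_mul, add_zero, one_mul] at h
  linarith

end Curvature

/-! ### Lower bound for the excess empirical loss -/

section Excess

variable {n m : ℕ} {Y : Set ℝ} {L : ℝ → ℝ → ℝ} {Λ : ℝ} {F : ℝ → ℝ}

/-- Where the truncated bump is nonzero, the whole segment of arguments lies in the interval of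
curvature at least κ, and the bump is at most the square. Elsewhere the bump vanishes and plain
convexity suffices. -/
theorem IsCurvedLoss.truncated_lower_bound (hL : IsCurvedLoss Y L Λ F) {y : ℝ} (hy : y ∈ Y)
    {κ R μ t : ℝ} (hκ : 0 ≤ κ) (hF : ∀ v : ℝ, |v| ≤ max (32 * R) (truncLevel * |μ|) → κ ≤ F v)
    (ht : 0 ≤ t) (htR : t ≤ R) (x₀ a u : EuclideanSpace ℝ (Fin n)) :
    lossDeriv L (μ * inner ℝ a x₀) y * (t * inner ℝ a u) + κ / 2 * t ^ 2 * truncTent x₀ a u ≤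
      L (μ * inner ℝ a x₀ + t * inner ℝ a u) y - L (μ * inner ℝ a x₀) y := by
  set g := inner ℝ a x₀ with hg
  set w := inner ℝ a u with hw
  by_cases hc : |g| ≤ truncLevel / 2 ∧ |w| < 3
  · have hT : truncTent x₀ a u ≤ w ^ 2 := by
      rw [truncTent, if_pos hc.1]; exact tent_le_sq _
    have h := hL.quadratic_lower_bound hy (v := μ * g) (x := t * w) (k := κ) fun θ hθ => by
      refine hF _ ?_
      have h1 : |μ * g| ≤ truncLevel * |μ| / 2 := by
        rw [abs_mul]
        nlinarith [mul_le_mul_of_nonneg_left hc.1 (abs_nonneg μ)]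
      have h2 : |θ * (t * w)| ≤ 3 * R := by
        rw [abs_mul, abs_mul, abs_of_nonneg hθ.1, abs_of_nonneg ht]
        have h3 : t * |w| ≤ R * 3 :=
          mul_le_mul htR hc.2.le (abs_nonneg _) (ht.trans htR)
        have h4 : θ * (t * |w|) ≤ t * |w| :=
          mul_le_of_le_one_left (mul_nonneg ht (abs_nonneg _)) hθ.2
        linarith
      -- The two contributions are at most c|μ|/2 and 3R ≤ 16R, each at most half of the maximum.
      have h5 := le_max_left (32 * R) (truncLevel * |μ|)
      have h6 := le_max_right (32 * R) (truncLevel * |μ|)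
      refine (abs_add_le _ _).trans ?_
      linarith [ht.trans htR]
    have h7 : κ / 2 * t ^ 2 * truncTent x₀ a u ≤ κ / 2 * t ^ 2 * w ^ 2 :=
      mul_le_mul_of_nonneg_left hT (by positivity)
    rw [mul_pow] at h
    linarith
  · have hT : truncTent x₀ a u = 0 := by
      unfold truncTent
      split_ifs with h1
      · exact tent_eq_zero (not_lt.1 fun h2 => hc ⟨h1, h2⟩)
      · rfl
    have h := hL.quadratic_lower_bound hy (v := μ * g) (x := t * w) (k := 0)
      fun θ _ => (hL.curvature_pos _).le
    rw [hT]
    linarith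

theorem sum_abs_mul_le_advNoise (hm : 0 < m) (y' y w : Fin m → ℝ) {B : ℝ}
    (hw : ∑ i, w i ^ 2 ≤ B * m) :
    ∑ i, |y' i - y i| * |w i| ≤ advNoise y' y * m * Real.sqrt B := by
  have hm' : (0 : ℝ) < m := by exact_mod_cast hm
  refine (Real.sum_mul_le_sqrt_mul_sqrt Finset.univ (fun i => |y' i - y i|) fun i => |w i|).trans ?_
  have h1 : Real.sqrt (∑ i, |y' i - y i| ^ 2) = Real.sqrt m * advNoise y' y := by
    rw [advNoise, ← Real.sqrt_mul hm'.le]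
    congr 1
    field_simp
  have h2 : Real.sqrt (∑ i, |w i| ^ 2) ≤ Real.sqrt B * Real.sqrt m := by
    simp_rw [sq_abs]
    rw [← Real.sqrt_mul' _ hm'.le]
    exact Real.sqrt_le_sqrt hw
  have hε : 0 ≤ advNoise y' y := Real.sqrt_nonneg _
  rw [h1]
  calc _ ≤ Real.sqrt m * advNoise y' y * (Real.sqrt B * Real.sqrt m) := by gcongr
    _ = advNoise y' y * (Real.sqrt m * Real.sqrt m) * Real.sqrt B := by ring
    _ = _ := by rw [Real.mul_self_sqrt hm'.le]

/-- The empirical loss increases strictly at distance `t` in a regular direction. -/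
theorem empLoss_lt_of_regularDirection (hm : 0 < m) (hL : IsCurvedLoss Y L Λ F)
    {κ R μ t : ℝ} (hΛ : 0 ≤ Λ) (hκ : 0 ≤ κ)
    (hF : ∀ v : ℝ, |v| ≤ max (32 * R) (truncLevel * |μ|) → κ ≤ F v)
    (ht : 0 < t) (htR : t ≤ R) {x₀ u : EuclideanSpace ℝ (Fin n)}
    {a : Fin m → EuclideanSpace ℝ (Fin n)} {y y' : Fin m → ℝ} (hy : ∀ i, y i ∈ Y)
    (hy' : ∀ i, y' i ∈ Y) {A B : ℝ}
    (hreg : RegularDirection x₀ B A a (fun i => lossDeriv L (μ * inner ℝ (a i) x₀) (y i)) u)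
    (hlarge : A / m + Λ * advNoise y' y * Real.sqrt B < κ * tentMean / 8 * t) :
    empLoss L a y' (μ • x₀) < empLoss L a y' (μ • x₀ + t • u) := by
  have hm' : (0 : ℝ) < m := by exact_mod_cast hm
  unfold empLoss
  refine mul_lt_mul_of_pos_left ?_ (by positivity)
  rw [← sub_pos, ← Finset.sum_sub_distrib]
  have hterm : ∀ i, t * (lossDeriv L (μ * inner ℝ (a i) x₀) (y i) * inner ℝ (a i) u)
      - t * Λ * (|y' i - y i| * |inner ℝ (a i) u|) + κ / 2 * t ^ 2 * truncTent x₀ (a i) u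
      ≤ L (inner ℝ (a i) (μ • x₀ + t • u)) (y' i) - L (inner ℝ (a i) (μ • x₀)) (y' i) := by
    intro i
    have h1 := hL.truncated_lower_bound (hy' i) hκ hF ht.le htR x₀ (a i) u
    have h2 := hL.lipschitz (μ * inner ℝ (a i) x₀) (y' i) (hy' i) (y i) (hy i)
    have h3 : -(Λ * |y' i - y i| * |inner ℝ (a i) u|) ≤
        (lossDeriv L (μ * inner ℝ (a i) x₀) (y' i) - lossDeriv L (μ * inner ℝ (a i) x₀) (y i))
          * inner ℝ (a i) u := by
      refine (neg_le_neg (mul_le_mul_of_nonneg_right h2 (abs_nonneg _))).trans ?_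
      rw [← abs_mul]
      exact neg_abs_le _
    have h4 := mul_le_mul_of_nonneg_left h3 ht.le
    simp only [inner_add_right, real_inner_smul_right]
    nlinarith
  refine lt_of_lt_of_le ?_ (Finset.sum_le_sum fun i _ => hterm i)
  rw [Finset.sum_add_distrib, Finset.sum_sub_distrib, ← Finset.mul_sum, ← Finset.mul_sum,
    ← Finset.mul_sum]
  -- The bump bound `tentMean / 4` times the Taylor factor κ/2 gives the constant κ `tentMean` / 8
  -- in `hlarge`.
  have e1 := mul_le_mul_of_nonneg_left hreg.multiplier ht.le
  have e2 := mul_le_mul_of_nonneg_left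
    (sum_abs_mul_le_advNoise hm y' y _ hreg.second) (mul_nonneg ht.le hΛ)
  have e3 := mul_le_mul_of_nonneg_left hreg.bump (show 0 ≤ κ / 2 * t ^ 2 by positivity)
  have e4 := mul_lt_mul_of_pos_left hlarge (mul_pos ht hm')
  have e5 : t * m * (A / m + Λ * advNoise y' y * Real.sqrt B)
      = t * A + t * Λ * (advNoise y' y * m * Real.sqrt B) := by
    field_simp
  rw [e5] at e4
  nlinarith

/-- The empirical loss is convex along segments. -/
theorem empLoss_segment_le (hL : IsCurvedLoss Y L Λ F) {a : Fin m → EuclideanSpace ℝ (Fin n)}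
    {y : Fin m → ℝ} (hy : ∀ i, y i ∈ Y) {x₁ x₂ : EuclideanSpace ℝ (Fin n)} {p q : ℝ}
    (hp : 0 ≤ p) (hq : 0 ≤ q) (hpq : p + q = 1) :
    empLoss L a y (p • x₁ + q • x₂) ≤ p * empLoss L a y x₁ + q * empLoss L a y x₂ := by
  unfold empLoss
  have h : ∀ i, L (inner ℝ (a i) (p • x₁ + q • x₂)) (y i) ≤
      p * L (inner ℝ (a i) x₁) (y i) + q * L (inner ℝ (a i) x₂) (y i) := by
    intro i
    have := (hL.convex (y i) (hy i)).2 (Set.mem_univ (inner ℝ (a i) x₁))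
      (Set.mem_univ (inner ℝ (a i) x₂)) hp hq hpq
    simpa only [inner_add_right, real_inner_smul_right, smul_eq_mul] using this
  have h2 := mul_le_mul_of_nonneg_left (Finset.sum_le_sum fun i (_ : i ∈ Finset.univ) => h i)
    (show (0 : ℝ) ≤ 1 / m by positivity)
  refine h2.trans (le_of_eq ?_)
  rw [Finset.sum_add_distrib, ← Finset.mul_sum, ← Finset.mul_sum]
  ring

end Excess

/-! ### Constants and the deterministic error bound -/

/-- The multiplier constant in the regularity condition at failure probability `δ`. -/
noncomputable def multiplierConst (δ : ℝ) : ℝ := 1 + 2 / (δ / 3)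

/-- The second moment constant in the regularity condition at failure probability `δ`. -/
noncomputable def secondMomentConst (δ : ℝ) : ℝ := 16 * (1 + gaussianSqMoment + 1 / (δ / 3))

/-- The constant of the error bound. -/
noncomputable def lassoConst (δ Λ κ : ℝ) : ℝ :=
  1 + 8 * (multiplierConst δ * (1 + 1 / posPartMean) + Λ * Real.sqrt (secondMomentConst δ)) /
    (κ * tentMean) + 24 / (tentMean * δ)

theorem multiplierConst_pos {δ : ℝ} (hδ : 0 < δ) : 0 < multiplierConst δ := by
  unfold multiplierConst; positivity

/-- The three summands of `lassoConst` serve in turn to give C ≥ 1 and strictness, to let curvature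
dominate the multiplier and corruption terms, and to make the sample size sufficient for the bump
estimate. -/
theorem lassoConst_bounds {δ Λ κ : ℝ} (hδ : 0 < δ) (hΛ : 0 < Λ) (hκ : 0 < κ) :
    1 ≤ lassoConst δ Λ κ ∧ 24 / (tentMean * δ) ≤ lassoConst δ Λ κ ∧
    multiplierConst δ * (1 + 1 / posPartMean) + Λ * Real.sqrt (secondMomentConst δ) <
      κ * tentMean / 8 * lassoConst δ Λ κ := by
  have hp := tentMean_pos
  have hq := posPartMean_pos
  have hk := multiplierConst_pos hδ
  set H := multiplierConst δ * (1 + 1 / posPartMean) + Λ * Real.sqrt (secondMomentConst δ) with hH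
  have hH0 : 0 ≤ H := by positivity
  have h1 : 0 ≤ 8 * H / (κ * tentMean) := by positivity
  have h2 : 0 ≤ 24 / (tentMean * δ) := by positivity
  have h3 : lassoConst δ Λ κ = 1 + 8 * H / (κ * tentMean) + 24 / (tentMean * δ) := rfl
  refine ⟨by linarith, by linarith, ?_⟩
  rw [h3]
  have h4 : κ * tentMean / 8 * (8 * H / (κ * tentMean)) = H := by field_simp
  have h5 : 0 < κ * tentMean / 8 := by positivity
  nlinarith

/-- With s the fourth root, the identity s²√m = w is what turns w/r into a multiple of s√m when r is
a multiple of s. -/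
theorem scale_facts {m : ℕ} (hm : 0 < m) {w C : ℝ} (hw : 0 < w) (hC : 1 ≤ C)
    (hmw : C * w ^ 2 ≤ m) :
    0 < (w ^ 2 / (m : ℝ)) ^ (1 / 4 : ℝ) ∧ (w ^ 2 / (m : ℝ)) ^ (1 / 4 : ℝ) ≤ 1 ∧
    ((w ^ 2 / (m : ℝ)) ^ (1 / 4 : ℝ)) ^ 2 * Real.sqrt m = w := by
  have hm' : (0 : ℝ) < m := by exact_mod_cast hm
  have hpos : 0 < w ^ 2 / (m : ℝ) := by positivity
  refine ⟨Real.rpow_pos_of_pos hpos _, Real.rpow_le_one hpos.le ?_ (by norm_num), ?_⟩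
  · rw [div_le_one hm']
    nlinarith [sq_nonneg w]
  · have h : ((w ^ 2 / (m : ℝ)) ^ (1 / 4 : ℝ)) ^ 2 = Real.sqrt (w ^ 2 / m) := by
      rw [← Real.rpow_natCast, ← Real.rpow_mul hpos.le, Real.sqrt_eq_rpow]
      norm_num
    rw [h, ← Real.sqrt_mul hpos.le, div_mul_cancel₀ _ hm'.ne', Real.sqrt_sq hw.le]

theorem errorBound_nonneg {C σ η w ε : ℝ} {m : ℕ} (hC : 0 ≤ C) (hε : 0 ≤ ε) :
    0 ≤ errorBound C σ η w m ε := by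
  unfold errorBound
  have : 0 ≤ max 1 (max σ η) := le_max_of_le_left zero_le_one
  have h2 : 0 ≤ (w ^ 2 / (m : ℝ)) ^ (1 / 4 : ℝ) := Real.rpow_nonneg (by positivity) _
  exact mul_nonneg (mul_nonneg hC this) (add_nonneg h2 hε)

theorem advNoise_nonneg {m : ℕ} (y' y : Fin m → ℝ) : 0 ≤ advNoise y' y := Real.sqrt_nonneg _

/-- The set of unit vectors `u` with `r • u ∈ S`. -/
def directions {n : ℕ} (S : Set (EuclideanSpace ℝ (Fin n))) (r : ℝ) :
    Set (EuclideanSpace ℝ (Fin n)) :=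
  {u | ‖u‖ = 1 ∧ r • u ∈ S}

theorem smul_mem_of_le {n : ℕ} {S : Set (EuclideanSpace ℝ (Fin n))} (hS : Convex ℝ S)
    (h0 : 0 ∈ S) {h : EuclideanSpace ℝ (Fin n)} (hh : h ∈ S) (hpos : 0 < ‖h‖) {r : ℝ}
    (hr : 0 ≤ r) (hrh : r ≤ ‖h‖) : r • (‖h‖⁻¹ • h) ∈ S := by
  rw [smul_smul]
  refine hS.smul_mem_of_zero_mem h0 hh ⟨by positivity, ?_⟩
  rw [← div_eq_mul_inv]
  exact (div_le_one hpos).2 hrh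

/-- If all directions at scale `r` are regular, every minimizer obeys the error bound. -/
theorem norm_sub_le_of_regularDirection {n m : ℕ} (hm : 0 < m) {Y : Set ℝ} {L : ℝ → ℝ → ℝ}
    {F : ℝ → ℝ} {δ Λ κ : ℝ} (hδ : 0 < δ) (hΛ : 0 < Λ) (hκ : 0 < κ) (hL : IsCurvedLoss Y L Λ F)
    {K : Set (EuclideanSpace ℝ (Fin n))} {x₀ : EuclideanSpace ℝ (Fin n)} {μ σ η R : ℝ}
    (hKb : Bornology.IsBounded ((fun x => x - μ • x₀) '' K)) (hK : Convex ℝ K)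
    (hμK : μ • x₀ ∈ K) {a : Fin m → EuclideanSpace ℝ (Fin n)} {y y' : Fin m → ℝ}
    (hy : ∀ i, y i ∈ Y) (hy' : ∀ i, y' i ∈ Y)
    (hw : 0 < meanWidth ((fun x => x - μ • x₀) '' K))
    (hR : K ⊆ Metric.closedBall (μ • x₀) R ∨
      errorBound (lassoConst δ Λ κ) σ η (meanWidth ((fun x => x - μ • x₀) '' K)) m
        (advNoise y' y) ≤ R)
    (hF : ∀ v : ℝ, |v| ≤ max (32 * R) (truncLevel * |μ|) → κ ≤ F v)
    (hmw : lassoConst δ Λ κ * meanWidth ((fun x => x - μ • x₀) '' K) ^ 2 ≤ m)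
    (hreg : ∀ u ∈ directions ((fun x => x - μ • x₀) '' K)
        (errorBound (lassoConst δ Λ κ) σ η (meanWidth ((fun x => x - μ • x₀) '' K)) m 0),
      RegularDirection x₀ (secondMomentConst δ)
        (multiplierConst δ * (Real.sqrt m * max 1 (max σ η)) *
          (meanWidth ((fun x => x - μ • x₀) '' K) /
            errorBound (lassoConst δ Λ κ) σ η (meanWidth ((fun x => x - μ • x₀) '' K)) m 0 + 1))
        a (fun i => lossDeriv L (μ * inner ℝ (a i) x₀) (y i)) u)
    {xhat : EuclideanSpace ℝ (Fin n)} (hx : IsEstimate L a y' K xhat) :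
    ‖xhat - μ • x₀‖ ≤ errorBound (lassoConst δ Λ κ) σ η
      (meanWidth ((fun x => x - μ • x₀) '' K)) m (advNoise y' y) := by
  obtain ⟨hC1, -, hC3⟩ := lassoConst_bounds hδ hΛ hκ
  set S := (fun x => x - μ • x₀) '' K with hS
  set w := meanWidth S with hwdef
  set C := lassoConst δ Λ κ with hC
  set M := max 1 (max σ η) with hM
  set ε := advNoise y' y with hε
  have hε0 : 0 ≤ ε := advNoise_nonneg _ _
  have hM1 : 1 ≤ M := le_max_left _ _
  have hm' : (0 : ℝ) < m := by exact_mod_cast hm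
  have hSconv : Convex ℝ S := by
    have := hK.translate (-(μ • x₀))
    simpa [hS, sub_eq_neg_add] using this
  have hS0 : (0 : EuclideanSpace ℝ (Fin n)) ∈ S := ⟨μ • x₀, hμK, sub_self _⟩
  obtain ⟨hs0, hs1, hsw⟩ := scale_facts hm hw hC1 hmw
  set s := (w ^ 2 / (m : ℝ)) ^ (1 / 4 : ℝ) with hs
  -- The scale `r` leaves out ε and is therefore deterministic, whereas `t` depends on the
  -- corruption. Since r ≤ t, the direction of a distant minimizer is also admissible at scale `r`.
  set r := errorBound C σ η w m 0 with hr
  have hr' : r = C * M * s := by rw [hr, errorBound, add_zero]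
  set t := errorBound C σ η w m ε with ht
  have ht' : t = C * M * (s + ε) := rfl
  have hCM : 1 ≤ C * M := by nlinarith
  have hr0 : 0 < r := by rw [hr']; positivity
  have hrt : r ≤ t := by
    rw [hr', ht']
    exact mul_le_mul_of_nonneg_left (by linarith) (by linarith)
  by_contra hcon
  push Not at hcon
  set h := xhat - μ • x₀ with hh
  have hhS : h ∈ S := ⟨xhat, hx.1, rfl⟩
  have ht0 : 0 < t := hr0.trans_le hrt
  have hhpos : 0 < ‖h‖ := ht0.trans hcon
  set u := ‖h‖⁻¹ • h with hu
  have hu1 : ‖u‖ = 1 := by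
    rw [hu, norm_smul, norm_inv, norm_norm, inv_mul_cancel₀ hhpos.ne']
  have hrS : r • u ∈ S := smul_mem_of_le hSconv hS0 hhS hhpos hr0.le (hrt.trans hcon.le)
  have htS : t • u ∈ S := smul_mem_of_le hSconv hS0 hhS hhpos ht0.le hcon.le
  -- If `R` only bounds the radius of `K`, the point of `K` at distance `t` from μx₀ still forces t
  -- ≤ R.
  have htR : t ≤ R := by
    rcases hR with hR | hR
    · obtain ⟨x, hxK, hxt⟩ := htS
      have h1 := hR hxK
      rw [Metric.mem_closedBall, dist_eq_norm] at h1
      dsimp only at hxt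
      rw [hxt, norm_smul, hu1, mul_one, Real.norm_of_nonneg ht0.le] at h1
      exact h1
    · exact hR
  have hW := mul_posPartMean_le_meanWidth hKb hS0 hu1 hr0.le hrS
  have hlarge : multiplierConst δ * (Real.sqrt m * M) * (w / r + 1) / m
      + Λ * ε * Real.sqrt (secondMomentConst δ) < κ * tentMean / 8 * t := by
    have hk := multiplierConst_pos hδ
    have hq := posPartMean_pos
    have hB : 0 ≤ Real.sqrt (secondMomentConst δ) := Real.sqrt_nonneg _
    have h1 : w / r + 1 ≤ w / r * (1 + 1 / posPartMean) := by
      have h2 : 1 ≤ w / r * (1 / posPartMean) := by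
        rw [div_mul_div_comm, mul_one, le_div_iff₀ (by positivity), one_mul]
        exact hW
      linarith
    -- The factor M in `r` cancels the multiplier size, and the identity for w leaves a multiple of
    -- s.
    have h3 : Real.sqrt m * M * (w / r) / m = s / C := by
      rw [← hsw, hr']
      have : (m : ℝ) = Real.sqrt m * Real.sqrt m := (Real.mul_self_sqrt hm'.le).symm
      rw [div_eq_iff hm'.ne']
      conv_rhs => rw [this]
      have hM0 : M ≠ 0 := by positivity
      have hC0 : C ≠ 0 := by positivity
      field_simp
    have h4 : multiplierConst δ * (Real.sqrt m * M) * (w / r + 1) / m ≤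
        multiplierConst δ * (1 + 1 / posPartMean) * s := by
      calc _ ≤ multiplierConst δ * (Real.sqrt m * M) * (w / r * (1 + 1 / posPartMean)) / m := by
            gcongr
        _ = multiplierConst δ * (1 + 1 / posPartMean) * (Real.sqrt m * M * (w / r) / m) := by ring
        _ ≤ _ := by
            rw [h3]
            exact mul_le_mul_of_nonneg_left (div_le_self hs0.le hC1) (by positivity)
    have h5 : κ * tentMean / 8 * C * (s + ε) ≤ κ * tentMean / 8 * t := by
      have hp := tentMean_pos
      rw [ht', mul_assoc]
      refine mul_le_mul_of_nonneg_left ?_ (by positivity)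
      exact mul_le_mul_of_nonneg_right (le_mul_of_one_le_right (by linarith) hM1) (by linarith)
    have h6 := mul_lt_mul_of_pos_right hC3 (by linarith : 0 < s + ε)
    have h7 : 0 ≤ multiplierConst δ * (1 + 1 / posPartMean) * ε := by positivity
    have h8 : 0 ≤ Λ * Real.sqrt (secondMomentConst δ) * s := by positivity
    linarith
  have hgt := empLoss_lt_of_regularDirection hm hL hΛ.le hκ.le hF ht0 htR hy hy'
    (hreg u ⟨hu1, hrS⟩) hlarge
  have hmin : empLoss L a y' xhat ≤ empLoss L a y' (μ • x₀) := hx.2 hμK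
  have hθ : t / ‖h‖ ≤ 1 := (div_le_one hhpos).2 hcon.le
  -- The point at distance `t` lies on the segment from μx₀ to the minimizer. Convexity bounds its
  -- loss by that at μx₀, against the strict increase.
  have hseg := empLoss_segment_le (a := a) hL hy' (x₁ := μ • x₀) (x₂ := xhat)
    (p := 1 - t / ‖h‖) (q := t / ‖h‖) (by linarith) (by positivity) (by ring)
  have hpt : (1 - t / ‖h‖) • (μ • x₀) + (t / ‖h‖) • xhat = μ • x₀ + t • u := by
    have htu : t • u = (t / ‖h‖) • h := by rw [hu, smul_smul t, div_eq_mul_inv]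
    rw [htu]
    generalize t / ‖h‖ = q
    rw [hh]
    module
  rw [hpt] at hseg
  have hq0 : 0 ≤ t / ‖h‖ := by positivity
  nlinarith

end GenLasso

/-! ### The main theorem -/

theorem mainTheorem4 :
    ∃ c : ℝ, 0 < c ∧
      -- `C` depends only on the failure probability `δ`, the Lipschitz constant `Λ` of `L'` in its
      -- second variable, and the lower bound `κ` for the curvature of the loss
      ∀ δ Λ κ : ℝ, 0 < δ → 0 < Λ → 0 < κ →
      ∃ C : ℝ, 0 < C ∧
      ∀ (n m : ℕ) (Ω : Type*) (Ξ : Type*) [MeasurableSpace Ω] [MeasurableSpace Ξ]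
        (P : Measure Ω) [IsProbabilityMeasure P] (ν : Measure Ξ) [IsProbabilityMeasure ν]
        (Y : Set ℝ) (f : Ξ → ℝ → ℝ) (L : ℝ → ℝ → ℝ) (F : ℝ → ℝ)
        (a : Fin m → Ω → EuclideanSpace ℝ (Fin n)) (s : Fin m → Ω → Ξ)
        (y ytil : Ω → Fin m → ℝ)
        (K : Set (EuclideanSpace ℝ (Fin n))) (x₀ : EuclideanSpace ℝ (Fin n))
        (μ σ η R : ℝ),
        0 < m →
        IsClosed Y →
        -- the observations `y` and their adversarial corruption `ytil`
        GenLasso.IsObservationModel P ν Y f a s →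
        (∀ ω i, y ω i = f (s i ω) (inner ℝ (a i ω) x₀)) →
        (∀ ω i, ytil ω i ∈ Y) →
        -- the loss and the model parameters
        GenLasso.IsCurvedLoss Y L Λ F →
        GenLasso.IsModelParam ν L f μ σ η →
        -- the ground truth and the signal set
        ‖x₀‖ = 1 →
        Bornology.IsBounded K → Convex ℝ K → μ • x₀ ∈ K →
        -- `κ` is a lower bound for the curvature on the relevant interval; the scale `R` is an upper
        -- bound for the radius of `K` around `μ x₀` or for the error bound itself
        (∀ᵐ ω ∂P, K ⊆ Metric.closedBall (μ • x₀) R ∨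
          GenLasso.errorBound C σ η (GenLasso.meanWidth ((fun x => x - μ • x₀) '' K)) m
            (GenLasso.advNoise (ytil ω) (y ω)) ≤ R) →
        (∀ v : ℝ, |v| ≤ max (32 * R) (c * |μ|) → κ ≤ F v) →
        -- the number of observations
        C * GenLasso.meanWidth ((fun x => x - μ • x₀) '' K) ^ 2 ≤ (m : ℝ) →
        -- with probability at least `1 - δ`, every minimizer obeys the error bound
        P {ω | ¬ ∀ xhat : EuclideanSpace ℝ (Fin n),
            GenLasso.IsEstimate L (fun i => a i ω) (ytil ω) K xhat →
            ‖xhat - μ • x₀‖ ≤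
              GenLasso.errorBound C σ η (GenLasso.meanWidth ((fun x => x - μ • x₀) '' K)) m
                (GenLasso.advNoise (ytil ω) (y ω))} ≤ ENNReal.ofReal δ := by
  refine ⟨GenLasso.truncLevel, GenLasso.truncLevel_pos, fun δ Λ κ hδ hΛ hκ => ?_⟩
  obtain ⟨hC1, hC2, -⟩ := GenLasso.lassoConst_bounds hδ hΛ hκ
  refine ⟨GenLasso.lassoConst δ Λ κ, by linarith, ?_⟩
  intro n m Ω Ξ _ _ P _ ν _ Y f L F a s y ytil K x₀ μ σ η R hm _ hmodel hyf hytil hL hpar hx₀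
    hKb hK hμK hR hF hmw
  have hSb : Bornology.IsBounded ((fun x => x - μ • x₀) '' K) := by
    rw [← Set.sub_singleton]
    exact hKb.sub Bornology.isBounded_singleton
  set S := (fun x => x - μ • x₀) '' K with hS
  set C := GenLasso.lassoConst δ Λ κ with hC
  have hS0 : (0 : EuclideanSpace ℝ (Fin n)) ∈ S := ⟨μ • x₀, hμK, sub_self _⟩
  -- If the width is not positive, `K` is the single point μx₀ and the bound is trivial; otherwise
  -- `r` is positive and can be divided by.
  rcases le_or_gt (GenLasso.meanWidth S) 0 with hw | hw
  · have hbad : {ω | ¬ ∀ xhat : EuclideanSpace ℝ (Fin n),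
        GenLasso.IsEstimate L (fun i => a i ω) (ytil ω) K xhat → ‖xhat - μ • x₀‖ ≤
          GenLasso.errorBound C σ η (GenLasso.meanWidth S) m
            (GenLasso.advNoise (ytil ω) (y ω))} = ∅ := by
      rw [Set.eq_empty_iff_forall_notMem]
      refine fun ω hω => hω fun xhat hxhat => ?_
      refine le_trans ?_ (GenLasso.errorBound_nonneg (by linarith) (GenLasso.advNoise_nonneg _ _))
      by_contra hpos
      push Not at hpos
      have h1 := GenLasso.mul_posPartMean_le_meanWidth hSb hS0
        (u := ‖xhat - μ • x₀‖⁻¹ • (xhat - μ • x₀))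
        (by rw [norm_smul, norm_inv, norm_norm, inv_mul_cancel₀ hpos.ne'])
        (r := ‖xhat - μ • x₀‖) hpos.le
        (by rw [smul_smul, mul_inv_cancel₀ hpos.ne', one_smul]; exact ⟨xhat, hxhat.1, rfl⟩)
      exact absurd (mul_pos hpos GenLasso.posPartMean_pos) (not_lt.2 (h1.trans hw))
    rw [hbad, measure_empty]
    exact zero_le
  have hm' : (0 : ℝ) < m := by exact_mod_cast hm
  obtain ⟨hs0, hs1, hsw⟩ := GenLasso.scale_facts hm hw hC1 hmw
  set r := GenLasso.errorBound C σ η (GenLasso.meanWidth S) m 0 with hr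
  set q := (GenLasso.meanWidth S ^ 2 / (m : ℝ)) ^ (1 / 4 : ℝ) with hq
  have hM1 : 1 ≤ max 1 (max σ η) := le_max_left _ _
  have hr' : r = C * max 1 (max σ η) * q := by rw [hr, GenLasso.errorBound, add_zero]
  have hCq : C * q ≤ r := by
    rw [hr']
    exact mul_le_mul_of_nonneg_right (le_mul_of_one_le_right (by linarith) hM1) hs0.le
  have hr0 : 0 < r := lt_of_lt_of_le (by positivity) hCq
  -- Since w = q²√m with q ≤ 1 and r ≥ C q, the width of the directions is at most √m/C. Both sample
  -- size conditions follow from this.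
  have hWr : GenLasso.meanWidth S / r ≤ Real.sqrt m / C := by
    rw [div_le_div_iff₀ hr0 (by linarith), ← hsw]
    calc q ^ 2 * Real.sqrt m * C = Real.sqrt m * q * (C * q) := by ring
      _ ≤ Real.sqrt m * 1 * r := by gcongr
      _ = Real.sqrt m * r := by ring
  have hWm : (GenLasso.meanWidth S / r) ^ 2 ≤ m := by
    have h1 : GenLasso.meanWidth S / r ≤ Real.sqrt m :=
      hWr.trans (div_le_self (Real.sqrt_nonneg _) hC1)
    calc _ ≤ Real.sqrt m ^ 2 := pow_le_pow_left₀ (by positivity) h1 2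
      _ = m := Real.sq_sqrt hm'.le
  have hWδ : 2 * (GenLasso.meanWidth S / r) ≤
      GenLasso.tentMean / 4 * (δ / 3) * Real.sqrt m := by
    have hp := GenLasso.tentMean_pos
    have h1 : 2 * (Real.sqrt m / C) ≤ GenLasso.tentMean / 4 * (δ / 3) * Real.sqrt m := by
      rw [div_le_iff₀ (by positivity)] at hC2
      rw [mul_div_assoc', div_le_iff₀ (by linarith)]
      nlinarith [mul_le_mul_of_nonneg_right hC2 (Real.sqrt_nonneg m)]
    linarith
  have hgood := GenLasso.measure_exists_mem_not_regularDirection_le hmodel hm hx₀ hpar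
    (U := GenLasso.directions S r) hSb hS0 hr0 (fun u hu => hu.1) (fun u hu => hu.2) hδ hw hWm hWδ
  refine le_trans ?_ hgood
  -- The condition on `R` holds only almost surely, so the bad event is included in the irregular
  -- one up to a null set.
  refine measure_mono_ae ?_
  filter_upwards [hR] with ω hRω hbad
  by_contra hreg
  refine hbad fun xhat hxhat => ?_
  refine GenLasso.norm_sub_le_of_regularDirection hm hδ hΛ hκ hL hSb hK hμK (y := y ω)
    (fun i => by rw [hyf]; exact hmodel.range_f _ _) (hytil ω) hw hRω hF hmw (fun u hu => ?_) hxhat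
  by_contra hu'
  refine hreg ⟨u, hu, fun hreg' => hu' ?_⟩
  simp only [hyf ω]
  exact hreg'
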